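/- A loop is a set $L$ with a binary operation having a two-sided identity $e$ such that the equations $a\cdot y=b$ and $x\cdot a=b$ are uniquely solvable for all $a,b\in L$; it is a topological loop if $L$ is a topological manifold and the multiplication and the two division maps are continuous. The group topologically generated by a set of homeomorphisms of $L$ is the smallest closed subgroup containing it of the homeomorphism group of $L$ (with the compact-open topology); $\mathrm{Mult}(L)$ denotes the group topologically generated by all left and right translations of $L$. For $n\ge 1$ let $\mathbb F_{n+2}$ be the elementary filiform Lie group: the simply connected Lie group whose Lie algebra has a basis $e_1,\dots,e_{n+2}$ with $[e_1,e_i]=(n+2-i)\,e_{i+1}$ for $2\le i\le n+1$, all other brackets of basis elements being zero. Let $L$ be a $2$-dimensional connected simply connected topological loop such that the group topologically generated by the left translations of $L$ is isomorphic, as a topological group, to $\mathbb F_3$. Then, in suitable global coordinates $L\cong\mathbb R^2$, the multiplication of $L$ is given by $$(u_1,z_1)*(u_2,z_2)=(u_1+u_2,\ z_1+z_2-u_2\,v_1(u_1)),$$ where $v_1:\mathbb R\to\mathbb R$ is a continuous function with $v_1(0)=0$ that is non-linear (not of the form $u\mapsto mu$). Moreover, for every such representation of $L$ and every integer $n>1$,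 the group $\mathrm{Mult}(L)$ is isomorphic, as a topological group, to $\mathbb F_{n+2}$ if and only if there are real numbers $a_1,\dots,a_n$ with $a_n\ne 0$ such that $$v_1(u)=(-1)^{n+1}a_nu^n+(-1)^{n}a_{n-1}u^{n-1}+\cdots+a_1u\qquad\text{for all }u\in\mathbb R.$$ -/

import Mathlib

/-! ### Topological loops -/

/-- A loop: a binary operation with a two-sided identity `1` such that `a * y = b` and `x * a = b`
have precisely one solution each, namely `y = ldiv a b` and `x = rdiv b a`. -/
class Loop (L : Type*) extends MulOneClass L where
  /-- `ldiv a b` is the solution `y` of `a * y = b`. -/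
  ldiv : L → L → L
  /-- `rdiv b a` is the solution `x` of `x * a = b`. -/
  rdiv : L → L → L
  mul_ldiv : ∀ a b : L, a * ldiv a b = b
  ldiv_mul : ∀ a b : L, ldiv a (a * b) = b
  rdiv_mul : ∀ b a : L, rdiv b a * a = b
  mul_rdiv : ∀ b a : L, rdiv (b * a) a = b

/-- The multiplication and the two divisions are continuous. -/
class IsTopologicalLoop (L : Type*) [TopologicalSpace L] [Loop L] : Prop where
  continuous_mul : Continuous fun p : L × L => p.1 * p.2
  continuous_ldiv : Continuous fun p : L × L => Loop.ldiv p.1 p.2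
  continuous_rdiv : Continuous fun p : L × L => Loop.rdiv p.1 p.2

namespace Loop

variable {L : Type*} [TopologicalSpace L] [Loop L] [IsTopologicalLoop L]

/-- The left translation `y ↦ a * y`. -/
def leftTranslation (a : L) : L ≃ₜ L where
  toFun y := a * y
  invFun y := ldiv a y
  left_inv y := ldiv_mul a y
  right_inv y := mul_ldiv a y
  continuous_toFun := IsTopologicalLoop.continuous_mul.comp (Continuous.prodMk_right a)
  continuous_invFun := IsTopologicalLoop.continuous_ldiv.comp (Continuous.prodMk_right a)

/-- The right translation `y ↦ y * a`. -/
def rightTranslation (a : L) : L ≃ₜ L where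
  toFun y := y * a
  invFun y := rdiv y a
  left_inv y := mul_rdiv y a
  right_inv y := rdiv_mul y a
  continuous_toFun := IsTopologicalLoop.continuous_mul.comp (Continuous.prodMk_left a)
  continuous_invFun := IsTopologicalLoop.continuous_rdiv.comp (Continuous.prodMk_left a)

end Loop

/-- The Arens topology on the group of homeomorphisms of a space: the coarsest topology for which
`f ↦ f` and `f ↦ f⁻¹` are continuous into the space of continuous maps with the compact-open
topology. (On a topological manifold it is the compact-open topology itself.) -/
instance Homeomorph.arensTopology (X : Type*) [TopologicalSpace X] : TopologicalSpace (X ≃ₜ X) :=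
  TopologicalSpace.induced
    (fun f : X ≃ₜ X => ((⟨f, f.continuous⟩ : C(X, X)), (⟨f.symm, f.symm.continuous⟩ : C(X, X))))
    inferInstance

/-- The group topologically generated by a set `S` of homeomorphisms: the smallest closed subgroup
of the group of all homeomorphisms that contains `S`. -/
def topologicallyGenerated {X : Type*} [TopologicalSpace X] (S : Set (X ≃ₜ X)) :
    Subgroup (X ≃ₜ X) :=
  sInf {H : Subgroup (X ≃ₜ X) | IsClosed (H : Set (X ≃ₜ X)) ∧ S ⊆ H}

/-- The group topologically generated by the left translations of a topological loop. -/
def leftTranslationGroup (L : Type*) [TopologicalSpace L] [Loop L] [IsTopologicalLoop L] :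
    Subgroup (L ≃ₜ L) :=
  topologicallyGenerated (Set.range (Loop.leftTranslation (L := L)))

/-- The group `Mult(L)` topologically generated by all left and right translations of a
topological loop. -/
def multiplicationGroup (L : Type*) [TopologicalSpace L] [Loop L] [IsTopologicalLoop L] :
    Subgroup (L ≃ₜ L) :=
  topologicallyGenerated
    (Set.range (Loop.leftTranslation (L := L)) ∪ Set.range (Loop.rightTranslation (L := L)))

/-- In suitable global coordinates `L ≅ ℝ × ℝ` (a homeomorphism) the multiplication of `L` reads
`(u₁, z₁) * (u₂, z₂) = (u₁ + u₂, z₁ + z₂ - u₂ v(u₁))`. -/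
def HasMultiplication (L : Type*) [TopologicalSpace L] [Loop L] (v : ℝ → ℝ) : Prop :=
  ∃ φ : L ≃ₜ ℝ × ℝ, ∀ x y : L,
    φ (x * y) = ((φ x).1 + (φ y).1, (φ x).2 + (φ y).2 - (φ y).1 * v (φ x).1)

/-! ### The elementary filiform groups

For `n ≥ 1`, the elementary filiform Lie group `𝔽_{n+2}` is the simply connected Lie group whose
Lie algebra has a basis `e₁, …, e_{n+2}` with `[e₁, eᵢ] = (n + 2 - i) eᵢ₊₁` for `2 ≤ i ≤ n + 1` and
all other brackets zero. It is built here as a group of matrices. The facts below show that this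
group is a closed subgroup of the general linear group, that it is simply connected (being
homeomorphic to `ℝ × ℝⁿ⁺¹`), and that its Lie algebra has such a basis. -/

namespace Filiform

open Matrix

/-- Matrices of size `n + 2`; the index `inr j` stands for the exponent `j ∈ {0, …, n}`. -/
abbrev Mat (n : ℕ) : Type := Matrix (Unit ⊕ Fin (n + 1)) (Unit ⊕ Fin (n + 1)) ℝ

/-- The matrix of `x ↦ x - c` on the powers `1, x, …, xⁿ`. -/
def shift (n : ℕ) (c : ℝ) : Matrix (Fin (n + 1)) (Fin (n + 1)) ℝ :=
  Matrix.of fun k j => (-c) ^ ((k : ℕ) - (j : ℕ)) * ((k : ℕ).choose (j : ℕ) : ℝ)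

/-- The group element `g(c, a₁, …, aₙ, a₀)`. -/
def elt (n : ℕ) (c : ℝ) (a : Fin (n + 1) → ℝ) : Mat n :=
  Matrix.fromBlocks 1 (Matrix.of fun _ j => a j) 0 (shift n c)

theorem shift_zero (n : ℕ) : shift n 0 = 1 := by
  ext k j
  simp only [shift, of_apply, neg_zero, one_apply]
  split_ifs with h
  · simp [h]
  · rcases lt_or_ge (k : ℕ) (j : ℕ) with h1 | h1
    · simp [Nat.choose_eq_zero_of_lt h1]
    · have : (k : ℕ) - (j : ℕ) ≠ 0 := by
        intro h2; exact h (Fin.ext (by omega))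
      simp [this]

theorem shift_add (n : ℕ) (c d : ℝ) : shift n c * shift n d = shift n (c + d) := by
  ext k l
  have h1 : ((Polynomial.X + Polynomial.C (-d)) + Polynomial.C (-c) : Polynomial ℝ) ^ (k : ℕ)
      = (Polynomial.X + Polynomial.C (-(c + d))) ^ (k : ℕ) := by
    congr 1
    rw [add_assoc, ← Polynomial.C_add]
    congr 2
    ring
  have h2 := congrArg (fun p => Polynomial.coeff p (l : ℕ)) h1
  simp only [Polynomial.coeff_X_add_C_pow] at h2
  rw [add_pow] at h2
  simp only [Polynomial.finsetSum_coeff] at h2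
  simp only [mul_apply, shift, of_apply]
  rw [← h2, Fin.sum_univ_eq_sum_range (fun j => ((-c) ^ ((k : ℕ) - j) * ((k : ℕ).choose j : ℝ)) *
    ((-d) ^ (j - (l : ℕ)) * (j.choose (l : ℕ) : ℝ))) (n + 1)]
  symm
  have hk : (k : ℕ) + 1 ≤ n + 1 := k.2
  refine (Finset.sum_congr rfl ?_).trans
    (Finset.sum_subset (Finset.range_mono hk) ?_)
  · intro j _
    rw [mul_assoc, ← Polynomial.C_pow, ← Polynomial.C_eq_natCast, ← Polynomial.C_mul,
      Polynomial.coeff_mul_C, Polynomial.coeff_X_add_C_pow]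
    ring
  · intro j _ hj
    have : (k : ℕ) < j := by simpa using hj
    simp [Nat.choose_eq_zero_of_lt this]

theorem elt_zero (n : ℕ) : elt n 0 0 = 1 := by
  rw [elt, shift_zero]
  ext i j
  rcases i with i | i <;> rcases j with j | j <;> simp [one_apply]

theorem elt_mul (n : ℕ) (c d : ℝ) (a b : Fin (n + 1) → ℝ) :
    elt n c a * elt n d b = elt n (c + d) (b + a ᵥ* shift n d) := by
  rw [elt, elt, elt, fromBlocks_multiply, ← shift_add]
  congr 1
  · simp
  · ext i j
    simp [mul_apply, vecMul, dotProduct]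
  · simp
  · simp

/-- The elementary filiform Lie group `𝔽_{n+2}`, `n ≥ 1`, a subgroup of the general linear group
with the subspace topology. -/
def group (n : ℕ) : Subgroup (Mat n)ˣ where
  carrier := {g | ∃ c a, (g : Mat n) = elt n c a}
  one_mem' := ⟨0, 0, (elt_zero n).symm⟩
  mul_mem' := by
    rintro g h ⟨c, a, hg⟩ ⟨d, b, hh⟩
    exact ⟨c + d, b + a ᵥ* shift n d, by rw [Units.val_mul, hg, hh, elt_mul]⟩
  inv_mem' := by
    rintro g ⟨c, a, hg⟩
    refine ⟨-c, -(a ᵥ* shift n (-c)), ?_⟩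
    rw [Units.inv_eq_of_mul_eq_one_right]
    rw [hg, elt_mul, add_neg_cancel, neg_add_cancel, elt_zero]

/-- The Lie algebra element with coordinates `c, a₁, …, aₙ, a₀`. -/
def lieElt (n : ℕ) (c : ℝ) (a : Fin (n + 1) → ℝ) : Mat n :=
  Matrix.fromBlocks 0 (Matrix.of fun _ j => a j) 0
    (Matrix.of fun k j : Fin (n + 1) => if (j : ℕ) + 1 = k then -c * (k : ℕ) else 0)

/-- `e n 0, …, e n (n + 1)` are the basis elements `e₁, …, e_{n+2}` of the Lie algebra. -/
def e (n : ℕ) : Fin (n + 2) → Mat n :=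
  Fin.cons (lieElt n 1 0) fun j => lieElt n 0 (Pi.single j.rev 1)

theorem sum_smul_e (n : ℕ) (x : Fin (n + 2) → ℝ) :
    ∑ i, x i • e n i = lieElt n (x 0) (fun j => x j.rev.succ) := by
  rw [Fin.sum_univ_succ]
  ext i j
  rcases i with i | i <;> rcases j with j | j
  · simp [e, lieElt, Matrix.sum_apply]
  · have h : ∀ k : Fin (n + 1), e n k.succ (Sum.inl i) (Sum.inr j) = if k = j.rev then 1 else 0 := by
      intro k
      have : j = k.rev ↔ k = j.rev := by rw [eq_comm, Fin.rev_eq_iff]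
      simp [e, lieElt, Pi.single_apply, this]
    have h0 : e n 0 (Sum.inl i) (Sum.inr j) = 0 := by simp [e, lieElt]
    simp [Matrix.sum_apply, h, h0, lieElt]
  · simp [e, lieElt, Matrix.sum_apply]
  · simp [e, lieElt, Matrix.sum_apply]

/-- The elements `e₁, …, e_{n+2}` are linearly independent. -/
theorem linearIndependent_e {n : ℕ} (hn : 1 ≤ n) : LinearIndependent ℝ (e n) := by
  rw [Fintype.linearIndependent_iff]
  intro x hx
  rw [sum_smul_e] at hx
  refine Fin.cases ?_ fun j => ?_
  · have := congrFun (congrFun hx (Sum.inr ⟨1, by omega⟩)) (Sum.inr ⟨0, by omega⟩)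
    simpa [lieElt] using this
  · have := congrFun (congrFun hx (Sum.inl ())) (Sum.inr j.rev)
    simpa [lieElt] using this

/-- `[e₁, eᵢ] = (n + 2 - i) eᵢ₊₁` for `i = j + 2`, `0 ≤ j < n`. -/
theorem lie_e_zero (n : ℕ) (j : Fin n) :
    ⁅e n 0, e n j.castSucc.succ⁆ = ((n : ℝ) - (j : ℕ)) • e n j.succ.succ := by
  have hj := j.2
  have hr : ((n - (j : ℕ) : ℕ) : ℝ) = (n : ℝ) - (j : ℕ) := by
    rw [Nat.cast_sub hj.le]
  simp only [e, lieElt, Fin.cons_zero, Fin.cons_succ, Ring.lie_def, fromBlocks_multiply]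
  ext a b
  rcases a with a | a <;> rcases b with b | b
  · simp
  · have hk : ∀ x : Fin (n + 1), x = j.castSucc.rev ↔ (x : ℕ) = n - j := by
      intro x; rw [Fin.ext_iff, Fin.val_rev]; simp
    have hb : b = j.succ.rev ↔ (b : ℕ) + 1 = n - j := by
      rw [Fin.ext_iff, Fin.val_rev]; simp; omega
    simp only [Matrix.sub_apply, Matrix.smul_apply, fromBlocks_apply₁₂, Matrix.add_apply, mul_apply,
      of_apply, Pi.single_apply, hb, hk]
    simp
    rw [Finset.sum_eq_single j.castSucc.rev]
    · simp [hr]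
      split_ifs <;> simp
    · intro x _ hx
      have : ¬ ((x : ℕ) = n - j) := fun h => hx ((hk x).2 h)
      simp [this]
    · simp
  · simp
  · simp [mul_apply]

/-- `[e₁, e_{n+2}] = 0`. -/
theorem lie_e_zero_last (n : ℕ) : ⁅e n 0, e n (Fin.last n).succ⁆ = 0 := by
  simp only [e, lieElt, Fin.cons_zero, Fin.cons_succ, Ring.lie_def, fromBlocks_multiply]
  ext a b
  rcases a with a | a <;> rcases b with b | b
  · simp
  · simp only [fromBlocks_apply₁₂, Matrix.sub_apply, Matrix.add_apply, mul_apply, of_apply,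
      Pi.single_apply, Fin.rev_last]
    simp
    refine Finset.sum_eq_zero fun x _ => ?_
    by_cases h : x = 0 <;> simp [h]
  · simp
  · simp [mul_apply]

/-- `[eᵢ, eⱼ] = 0` for `i, j ≥ 2`. -/
theorem lie_e_succ (n : ℕ) (i j : Fin (n + 1)) : ⁅e n i.succ, e n j.succ⁆ = 0 := by
  simp only [e, lieElt, Fin.cons_succ, Ring.lie_def, fromBlocks_multiply]
  ext a b
  rcases a with a | a <;> rcases b with b | b <;> simp [mul_apply]

theorem mem_span_e_iff (n : ℕ) (X : Mat n) :
    X ∈ Submodule.span ℝ (Set.range (e n)) ↔ ∃ c a, X = lieElt n c a := by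
  rw [Submodule.mem_span_range_iff_exists_fun]
  constructor
  · rintro ⟨x, rfl⟩
    exact ⟨_, _, sum_smul_e n x⟩
  · rintro ⟨c, a, rfl⟩
    refine ⟨Fin.cons c fun j => a j.rev, ?_⟩
    rw [sum_smul_e]
    simp

/-- An invertible matrix with the coordinates `c, a` lies in the group. -/
def unit (n : ℕ) (c : ℝ) (a : Fin (n + 1) → ℝ) : (Mat n)ˣ where
  val := elt n c a
  inv := elt n (-c) (-(a ᵥ* shift n (-c)))
  val_inv := by rw [elt_mul, add_neg_cancel, neg_add_cancel, elt_zero]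
  inv_val := by
    rw [elt_mul, neg_add_cancel, neg_vecMul, vecMul_vecMul, shift_add, neg_add_cancel, shift_zero,
      vecMul_one, add_neg_cancel, elt_zero]

theorem unit_mem (n : ℕ) (c : ℝ) (a : Fin (n + 1) → ℝ) : unit n c a ∈ group n := ⟨c, a, rfl⟩

theorem elt_coord {n : ℕ} (hn : 1 ≤ n) (c : ℝ) (a : Fin (n + 1) → ℝ) :
    -elt n c a (Sum.inr ⟨1, by omega⟩) (Sum.inr ⟨0, by omega⟩) = c := by
  simp [elt, shift]

theorem hasDerivAt_shift {n : ℕ} {c : ℝ → ℝ} {c' : ℝ} (h0 : c 0 = 0) (hc : HasDerivAt c c' 0)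
    (k j : Fin (n + 1)) :
    HasDerivAt (fun t => shift n (c t) k j) (if (j : ℕ) + 1 = k then -c' * (k : ℕ) else 0) 0 := by
  have h := ((hc.neg.pow ((k : ℕ) - (j : ℕ))).mul_const ((k : ℕ).choose (j : ℕ) : ℝ))
  refine h.congr_deriv ?_
  split_ifs with hjk
  · have : (k : ℕ).choose (j : ℕ) = k := by rw [← hjk]; simp
    rw [this]
    have : (k : ℕ) - (j : ℕ) = 1 := by omega
    simp [this]
  · rcases lt_or_ge (k : ℕ) (j : ℕ) with h1 | h1
    · simp [Nat.choose_eq_zero_of_lt h1]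
    · rcases h1.eq_or_lt with h2 | h2
      · simp [h2]
      · have : (k : ℕ) - (j : ℕ) - 1 ≠ 0 := by omega
        simp [h0, this]

/-- The Lie algebra of the group, that is, the set of velocities at the identity of the curves in
the group, is spanned by `e₁, …, e_{n+2}`. -/
theorem mem_span_e_iff_tangent {n : ℕ} (hn : 1 ≤ n) (X : Mat n) :
    X ∈ Submodule.span ℝ (Set.range (e n)) ↔
      ∃ γ : ℝ → (Mat n)ˣ, (∀ t, γ t ∈ group n) ∧ γ 0 = 1 ∧
        ∀ i j, HasDerivAt (fun t => (γ t : Mat n) i j) (X i j) 0 := by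
  rw [mem_span_e_iff]
  constructor
  · rintro ⟨c, a, rfl⟩
    refine ⟨fun t => unit n (t * c) (t • a), fun t => unit_mem _ _ _, ?_, ?_⟩
    · ext1
      simp [unit, elt_zero]
    · intro i j
      have hd : ∀ x : ℝ, HasDerivAt (fun t : ℝ => t * x) x 0 := fun x => by
        simpa using (hasDerivAt_id (0 : ℝ)).mul_const x
      rcases i with i | i <;> rcases j with j | j
      · exact hasDerivAt_const _ _
      · exact hd (a j)
      · exact hasDerivAt_const _ _
      · exact hasDerivAt_shift (by simp) (hd c) i j
  · rintro ⟨γ, hγ, h1, hd⟩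
    choose c a hca using hγ
    have hc : HasDerivAt c (-X (Sum.inr ⟨1, by omega⟩) (Sum.inr ⟨0, by omega⟩)) 0 := by
      refine (hd (Sum.inr ⟨1, by omega⟩) (Sum.inr ⟨0, by omega⟩)).neg.congr_of_eventuallyEq ?_
      filter_upwards with t
      simp only [Pi.neg_apply, hca]
      exact (elt_coord hn (c t) (a t)).symm
    have h0 : c 0 = 0 := by
      rw [← elt_coord hn (c 0) (a 0), ← hca, h1]
      simp
    simp only [hca] at hd
    refine ⟨-X (Sum.inr ⟨1, by omega⟩) (Sum.inr ⟨0, by omega⟩), fun j => X (Sum.inl ()) (Sum.inr j),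
      ?_⟩
    ext i j
    rcases i with i | i <;> rcases j with j | j
    · exact (hd _ _).unique (hasDerivAt_const _ _)
    · rfl
    · exact (hd _ _).unique (hasDerivAt_const _ _)
    · exact (hd _ _).unique (hasDerivAt_shift h0 hc i j)

theorem continuous_elt (n : ℕ) :
    Continuous fun p : ℝ × (Fin (n + 1) → ℝ) => elt n p.1 p.2 := by
  refine continuous_matrix fun i j => ?_
  rcases i with i | i <;> rcases j with j | j
  · exact continuous_const
  · exact (continuous_apply j).comp continuous_snd
  · exact continuous_const
  · exact (continuous_fst.neg.pow _).mul continuous_const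

/-- The coordinates `(c, a)` identify the group with `ℝ × ℝⁿ⁺¹`. -/
def homeomorph {n : ℕ} (hn : 1 ≤ n) : group n ≃ₜ ℝ × (Fin (n + 1) → ℝ) where
  toFun g := (-(g : (Mat n)ˣ).val (Sum.inr ⟨1, by omega⟩) (Sum.inr ⟨0, by omega⟩),
    fun j => (g : (Mat n)ˣ).val (Sum.inl ()) (Sum.inr j))
  invFun p := ⟨unit n p.1 p.2, unit_mem _ _ _⟩
  left_inv := by
    rintro ⟨g, c, a, hg⟩
    ext1
    ext1
    simp only [hg, elt_coord hn, unit]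
    rfl
  right_inv := by
    rintro ⟨c, a⟩
    exact Prod.ext (elt_coord hn c a) rfl
  continuous_toFun := by
    have h : Continuous fun g : group n => (g : (Mat n)ˣ).val :=
      Units.continuous_val.comp continuous_subtype_val
    exact (h.matrix_elem _ _).neg.prodMk (continuous_pi fun j => h.matrix_elem _ _)
  continuous_invFun := by
    refine Continuous.subtype_mk (Units.continuous_iff.2 ⟨continuous_elt n, ?_⟩) _
    have h : Continuous fun p : ℝ × (Fin (n + 1) → ℝ) =>
        ((-p.1, -(p.2 ᵥ* shift n (-p.1))) : ℝ × (Fin (n + 1) → ℝ)) := by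
      refine continuous_fst.neg.prodMk (Continuous.neg ?_)
      refine Continuous.matrix_vecMul continuous_snd (continuous_matrix fun k j => ?_)
      exact (continuous_fst.neg.neg.pow _).mul continuous_const
    exact (continuous_elt n).comp h

/-- The group is simply connected. -/
theorem simplyConnectedSpace_group {n : ℕ} (hn : 1 ≤ n) : SimplyConnectedSpace (group n) := by
  have : ContractibleSpace (group n) := (homeomorph hn).contractibleSpace
  infer_instance

/-- The group is a closed subgroup of the general linear group. -/
theorem isClosed_group {n : ℕ} (hn : 1 ≤ n) : IsClosed (group n : Set (Mat n)ˣ) := by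
  let F : Mat n → Mat n := fun M =>
    elt n (-M (Sum.inr ⟨1, by omega⟩) (Sum.inr ⟨0, by omega⟩)) fun j => M (Sum.inl ()) (Sum.inr j)
  have hF : Continuous F := (continuous_elt n).comp
    ((continuous_id.matrix_elem _ _).neg.prodMk
      (continuous_pi fun j => continuous_id.matrix_elem _ _))
  have h : (group n : Set (Mat n)ˣ) = {g : (Mat n)ˣ | (g : Mat n) = F g} := by
    ext g
    constructor
    · rintro ⟨c, a, hg⟩
      simp only [Set.mem_ofPred_eq, F, hg, elt_coord hn]
      rfl
    · intro hg
      exact ⟨_, _, hg⟩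
  rw [h]
  exact isClosed_eq Units.continuous_val (hF.comp Units.continuous_val)

end Filiform

/-! Normal form. Let `G` be the group generated by the left translations, here the Heisenberg group,
and `K` the stabilizer of `1`. Since `a ↦ leftTranslation a` is a continuous section of `g ↦ g 1`,
`K` is a retract of `G ≅ ℝ³`, hence connected. It contains no nontrivial central element, and it is
nontrivial because `ℝ³` is not homeomorphic to a surface. Such a closed subgroup is a one-parameter
group, and after an automorphism it is the middle coordinate axis
(`IsHeisenbergChart.eq_bot_or_exists_axis`). The other two coordinates then label the points of `L`,
and the middle coordinate of a left translation becomes `v`: right cancellation makes it depend on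
`u` only. A linear `v` would confine all left translations to a proper closed subgroup.

Multiplication group. All translations of `L` are shears `(u, z) ↦ (u + s, z + f u)`, with `f`
affine for left ones and `f = t - s v` for right ones. Non-linearity of `v` yields all shears `(s,
0)` and `(0, r v)` (`shear_mul_mem_of_left_right`). If `v` is a polynomial of degree `n`, its
translates span all polynomials of degree at most `n`, so `Mult(L)` is the group of shears by these,
which is the filiform group. Conversely, the filiform group satisfies the Engel identity of length
`n + 1`. Applied to the shear by `v` and a translation, it says that all differences of `v` of order
`n + 1` vanish, so `v` is a polynomial. Its degree is `n`, because no shorter Engel identity holds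
(`Filiform.eq_of_mulEquiv`). -/

/-! ### Invariance of dimension for `ℝ³` and surfaces -/

/-- A Borsuk–Ulam argument: the difference of `f` at antipodal points of a sphere would be a nowhere
zero function on a hemisphere, odd on the boundary circle, yet with a continuous logarithm. -/
theorem not_injective_of_continuous_prod_real (f : ℂ × ℝ → ℂ) (hf : Continuous f) :
    ¬ Function.Injective f := by
  intro hinj
  -- Over the unit disc this is a cone serving as the upper hemisphere; on the unit circle the
  -- height is zero, so `q (-z) = -q z` there.
  let q : ℂ → ℂ × ℝ := fun z => (z, max 0 (1 - ‖z‖))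
  have hq : Continuous q := by fun_prop
  have hq0 (z : ℂ) : q z ≠ -q z := by
    intro h
    have h1 : z = 0 := self_eq_neg.1 (congrArg Prod.fst h)
    have h2 : max 0 (1 - ‖z‖) = 0 := self_eq_neg.1 (congrArg Prod.snd h)
    simp [h1] at h2
  let F : ℂ → ℂ := fun z => f (q z) - f (-q z)
  have hF : Continuous F := by fun_prop
  have hF0 (z : ℂ) : F z ≠ 0 := fun h => hq0 z (hinj (sub_eq_zero.1 h))
  have hodd (z : ℂ) (hz : ‖z‖ = 1) : F (-z) = -F z := by
    simp [F, q, hz]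
  obtain ⟨l, ⟨-, hl⟩, -⟩ := Complex.isCoveringMapOn_exp.existsUnique_continuousMap_lifts
    ⟨F, hF⟩ (Complex.exp_log (hF0 0)) hF0
  have hl (z : ℂ) : Complex.exp (l z) = F z := congrFun hl z
  -- The function `d` changes sign between `0` and `π`. At a zero, `l (-z) - l z` is real, while its
  -- exponential is `-1`.
  let d : ℝ → ℝ := fun θ =>
    (l (-Complex.exp (θ * Complex.I)) - l (Complex.exp (θ * Complex.I))).im
  have hd : Continuous d := by fun_prop
  have hdpi : d Real.pi = -d 0 := by simp [d]
  obtain ⟨θ, hθ⟩ : 0 ∈ Set.range d := by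
    rcases le_total (d 0) 0 with h | h
    · exact mem_range_of_exists_le_of_exists_ge hd ⟨0, h⟩ ⟨Real.pi, by linarith⟩
    · exact mem_range_of_exists_le_of_exists_ge hd ⟨Real.pi, by linarith⟩ ⟨0, h⟩
  set z := Complex.exp (θ * Complex.I) with hz
  have hexp : Complex.exp (l (-z) - l z) = -1 := by
    rw [Complex.exp_sub, hl, hl, hodd z (Complex.norm_exp_ofReal_mul_I θ),
      neg_div, div_self (hF0 z)]
  have hre : l (-z) - l z = ((l (-z) - l z).re : ℂ) := Complex.ext (by simp) (by simpa [d] using hθ)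
  rw [hre, ← Complex.ofReal_exp] at hexp
  have := Complex.ofReal_injective (hexp.trans (by simp : (-1 : ℂ) = ((-1 : ℝ) : ℂ)))
  linarith [Real.exp_pos (l (-z) - l z).re]

theorem isEmpty_homeomorph_of_chartedSpace_plane (L : Type*) [TopologicalSpace L]
    [ChartedSpace (EuclideanSpace ℝ (Fin 2)) L] : IsEmpty (ℂ × ℝ ≃ₜ L) := by
  refine ⟨fun ψ => ?_⟩
  let c := chartAt (EuclideanSpace ℝ (Fin 2)) (ψ 0)
  have hopen : IsOpen (ψ ⁻¹' c.source) := c.open_source.preimage ψ.continuous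
  obtain ⟨r, hr, hball⟩ := Metric.isOpen_iff.1 hopen 0 (mem_chart_source _ _)
  -- A radial contraction of the whole space into the ball of radius `r`, whose image under `ψ` lies
  -- in one chart.
  let s : ℂ × ℝ → ℂ × ℝ := fun x => (r / (1 + ‖x‖)) • x
  have hpos (x : ℂ × ℝ) : 0 < 1 + ‖x‖ := by positivity
  have hs : Continuous s :=
    (continuous_const.div (by fun_prop) fun x => (hpos x).ne').smul continuous_id
  have hsn (x : ℂ × ℝ) : ‖s x‖ = r / (1 + ‖x‖) * ‖x‖ := by
    rw [norm_smul, Real.norm_of_nonneg (div_nonneg hr.le (hpos x).le)]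
  have hsr (x : ℂ × ℝ) : ‖s x‖ < r := by
    rw [hsn, div_mul_eq_mul_div, div_lt_iff₀ (hpos x)]
    linarith
  have hsinj : Function.Injective s := by
    intro x y hxy
    have h := congrArg norm hxy
    rw [hsn, hsn, div_mul_eq_mul_div, div_mul_eq_mul_div,
      div_eq_div_iff (hpos x).ne' (hpos y).ne'] at h
    have hn : ‖x‖ = ‖y‖ := mul_left_cancel₀ hr.ne' (by linarith)
    simp only [s, hn] at hxy
    exact smul_right_injective _ (div_pos hr (hpos y)).ne' hxy
  have hmem (x : ℂ × ℝ) : ψ (s x) ∈ c.source := hball (by simpa using hsr x)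
  let f : ℂ × ℝ → ℂ := fun x => Complex.orthonormalBasisOneI.repr.symm (c (ψ (s x)))
  refine not_injective_of_continuous_prod_real f ?_ ?_
  · exact (LinearIsometryEquiv.continuous _).comp
      (c.continuousOn.comp_continuous (ψ.continuous.comp hs) hmem)
  · intro x y hxy
    exact hsinj (ψ.injective (c.injOn (hmem x) (hmem y)
      (Complex.orthonormalBasisOneI.repr.symm.injective hxy)))

/-! ### Polynomials, finite differences and additive subgroups of the line -/

open Polynomial in
-- Fréchet's characterization of polynomials. Newton's formula gives a polynomial on each arithmetic
-- progression; progressions of step `1 / d` starting at a negative integer contain all natural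
-- numbers, so they share one polynomial. Density of the rationals finishes.
theorem exists_polynomial_eval_of_fwdDiff_iter_eq_zero (f : ℝ → ℝ) (hf : Continuous f) (N : ℕ)
    (h : ∀ s, (fwdDiff s)^[N] f = 0) : ∃ p : ℝ[X], ∀ u, f u = p.eval u := by
  have hvan (s : ℝ) (k : ℕ) (hk : N ≤ k) : (fwdDiff s)^[k] f = 0 := by
    obtain ⟨j, rfl⟩ := Nat.exists_eq_add_of_le' hk
    rw [Function.iterate_add_apply, h]
    clear hk
    induction j with
    | zero => rfl
    | succ j ih =>
      rw [Function.iterate_succ_apply']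
      rw [ih]
      funext x
      simp [fwdDiff]
  have hloc (y s : ℝ) (hs : s ≠ 0) : ∃ p : ℝ[X], ∀ m : ℕ, f (y + m * s) = p.eval (y + m * s) := by
    -- Newton's interpolation polynomial in the variable `(X - y) / s`, whose value at `y + m * s`
    -- is `m`.
    refine ⟨(∑ k ∈ Finset.range N, C ((fwdDiff s)^[k] f y / k.factorial) *
      descPochhammer ℝ k).comp (C s⁻¹ * (X - C y)), fun m => ?_⟩
    have h1 := shift_eq_sum_fwdDiff_iter s f m y
    have h2 : ∑ k ∈ Finset.range (m + 1), m.choose k • (fwdDiff s)^[k] f y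
        = ∑ k ∈ Finset.range N, m.choose k • (fwdDiff s)^[k] f y := by
      rcases le_total (m + 1) N with hm | hm
      · refine Finset.sum_subset (Finset.range_mono hm) fun k _ hk => ?_
        rw [Nat.choose_eq_zero_of_lt (by simpa using hk), zero_smul]
      · refine (Finset.sum_subset (Finset.range_mono hm) fun k _ hk => ?_).symm
        rw [hvan s k (by simpa using hk)]
        simp
    rw [h2, nsmul_eq_mul] at h1
    rw [h1, eval_comp, eval_finsetSum]
    refine Finset.sum_congr rfl fun k _ => ?_
    have h3 : s⁻¹ * (y + m * s - y) = m := by field_simp; ring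
    simp only [eval_mul, eval_C, eval_sub, eval_X, h3, descPochhammer_eval_eq_descFactorial,
      nsmul_eq_mul, Nat.descFactorial_eq_factorial_mul_choose, Nat.cast_mul]
    field_simp
  obtain ⟨p, hp⟩ := hloc 0 1 one_ne_zero
  refine ⟨p, fun u => ?_⟩
  refine congrFun (Rat.denseRange_cast.equalizer hf p.continuous ?_) u
  funext x
  -- The progression starts at `-M`, to the left of `x`, and its step is the inverse of the
  -- denominator, so it reaches `x`.
  obtain ⟨M, hM⟩ := exists_nat_gt (-x)
  have hd : (x.den : ℝ) ≠ 0 := by exact_mod_cast x.den_nz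
  obtain ⟨q, hq⟩ := hloc (-M) (x.den : ℝ)⁻¹ (inv_ne_zero hd)
  have hqp : q = p := by
    refine Polynomial.eq_of_infinite_eval_eq q p ?_
    refine (Set.infinite_range_of_injective (f := fun m : ℕ => (m : ℝ)) Nat.cast_injective).mono ?_
    rintro _ ⟨m, rfl⟩
    have h1 := hq ((M + m) * x.den)
    have h2 : (-(M : ℝ) + (((M + m) * x.den : ℕ) : ℝ) * (x.den : ℝ)⁻¹) = m := by
      push_cast
      field_simp
      ring
    have h3 := hp m
    rw [h2] at h1
    simp only [zero_add, mul_one] at h3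
    exact h1.symm.trans h3
  have hnum : 0 ≤ x.num + M * x.den := by
    have h1 : (0 : ℚ) ≤ (x + M) * x.den := by
      refine mul_nonneg (by linarith) (by positivity)
    rw [add_mul, Rat.mul_den_eq_num] at h1
    exact_mod_cast h1
  have h1 := hq (x.num + M * x.den).toNat
  have h2 : (-(M : ℝ) + ((x.num + M * x.den).toNat : ℝ) * (x.den : ℝ)⁻¹) = x := by
    have : ((x.num + M * x.den).toNat : ℝ) = x.num + M * x.den := by
      rw [← Int.cast_natCast, Int.toNat_of_nonneg hnum]
      push_cast
      rfl
    rw [this, Rat.cast_def]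
    field_simp
    ring
  rw [h2, hqp] at h1
  exact h1

namespace Polynomial

theorem degree_le_of_mem_degreeLT_succ {k : ℕ} {p : ℝ[X]} (hp : p ∈ degreeLT ℝ (k + 1)) :
    p.degree ≤ k := by
  rw [mem_degreeLT, degree_lt_iff_coeff_zero] at hp
  exact (degree_le_iff_coeff_zero _ _).2 fun m hm => hp m (by exact_mod_cast hm)

theorem taylor_sub_self_mem_degreeLT {k : ℕ} {p : ℝ[X]} (hp : p ∈ degreeLT ℝ (k + 1)) (r : ℝ) :
    taylor r p - p ∈ degreeLT ℝ k := by
  by_cases h0 : p = 0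
  · simp [h0]
  have h1 : (taylor r p - p).degree < p.degree := by
    rw [← degree_taylor p r]
    refine degree_sub_lt_left (degree_taylor p r) ?_ (leadingCoeff_taylor ..)
    rwa [Ne, taylor_eq_zero]
  rw [mem_degreeLT] at hp ⊢
  rw [degree_eq_natDegree h0] at hp h1
  have : p.natDegree < k + 1 := by exact_mod_cast hp
  refine h1.trans_le ?_
  exact_mod_cast Nat.le_of_lt_succ this

theorem degree_taylor_sub_self {k : ℕ} {p : ℝ[X]} (hp : p.degree = (k + 1 : ℕ)) {r : ℝ}
    (hr : r ≠ 0) : (taylor r p - p).degree = k := by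
  have hnat : p.natDegree = k + 1 := natDegree_eq_of_degree_eq_some hp
  have hlead : p.coeff (k + 1) ≠ 0 := by
    rw [← hnat]
    exact leadingCoeff_ne_zero.2 (by rintro rfl; simp at hnat)
  have hmem : taylor r p - p ∈ degreeLT ℝ (k + 1) := by
    refine taylor_sub_self_mem_degreeLT ?_ r
    rw [mem_degreeLT, hp]
    exact_mod_cast Nat.lt_succ_self _
  have he : p.eraseLead ∈ degreeLT ℝ (k + 1) := by
    rw [mem_degreeLT]
    refine (degree_eraseLead_lt ?_).trans_eq hp
    rintro rfl
    simp at hnat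
  -- The part of `p` below the leading term contributes only in degrees below `k`, so the binomial
  -- expansion of the leading monomial decides.
  have hcoeff : (taylor r p - p).coeff k = (k + 1) * r * p.coeff (k + 1) := by
    have h1 := coeff_eq_zero_of_degree_lt (mem_degreeLT.1 (taylor_sub_self_mem_degreeLT he r))
    have h2 : p = p.eraseLead + monomial (k + 1) (p.coeff (k + 1)) := by
      rw [← hnat]
      exact (eraseLead_add_monomial_natDegree_leadingCoeff p).symm
    have h3 : taylor r p - p = (taylor r p.eraseLead - p.eraseLead) +
        (C (p.coeff (k + 1)) * (X + C r) ^ (k + 1) - monomial (k + 1) (p.coeff (k + 1))) := by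
      conv_lhs => rw [h2, map_add, taylor_monomial]
      ring
    rw [h3, coeff_add, h1, coeff_sub, coeff_C_mul, coeff_X_add_C_pow, coeff_monomial]
    simp
    ring
  refine le_antisymm ?_ (le_degree_of_ne_zero ?_)
  · exact degree_le_of_mem_degreeLT_succ hmem
  · rw [hcoeff]
    positivity

/-- Differencing with step `1` lowers the degree by exactly one, so `W` contains a polynomial of
each degree up to `m`. -/
theorem degreeLT_le_of_taylor_mem (W : Submodule ℝ ℝ[X]) (hW : ∀ q ∈ W, taylor 1 q ∈ W) :
    ∀ (m : ℕ) (p : ℝ[X]), p ∈ W → p.degree = m → degreeLT ℝ (m + 1) ≤ W := by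
  intro m
  induction m with
  | zero =>
    intro p hp hdeg q hq
    rw [eq_C_of_degree_eq_zero hdeg] at hp
    have h0 : p.coeff 0 ≠ 0 := coeff_ne_zero_of_eq_degree hdeg
    have hq' : q = (q.coeff 0 / p.coeff 0) • C (p.coeff 0) := by
      rw [smul_C, smul_eq_mul, div_mul_cancel₀ _ h0]
      refine eq_C_of_degree_le_zero ?_
      exact degree_le_of_mem_degreeLT_succ hq
    rw [hq']
    exact W.smul_mem _ hp
  | succ m ih =>
    intro p hp hdeg q hq
    have hlow := ih _ (W.sub_mem (hW p hp) hp) (degree_taylor_sub_self hdeg one_ne_zero)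
    have h0 : p.coeff (m + 1) ≠ 0 := coeff_ne_zero_of_eq_degree hdeg
    rw [← sub_add_cancel q ((q.coeff (m + 1) / p.coeff (m + 1)) • p)]
    refine W.add_mem (hlow ?_) (W.smul_mem _ hp)
    rw [mem_degreeLT, degree_lt_iff_coeff_zero]
    intro k hk
    rcases hk.eq_or_lt with rfl | hk
    · simp [h0]
    · rw [mem_degreeLT, degree_lt_iff_coeff_zero] at hq
      rw [coeff_sub, coeff_smul, hq k hk, coeff_eq_zero_of_degree_lt (p := p) (n := k)]
      · simp
      · rw [hdeg]
        exact_mod_cast hk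

end Polynomial

theorem AddSubgroup.eq_top_of_uIcc_subset (A : AddSubgroup ℝ) {d : ℝ} (hd : d ≠ 0)
    (h : Set.uIcc 0 d ⊆ A) : A = ⊤ := by
  have key (r : ℝ) (hr : 0 ≤ r) : d * r ∈ A := by
    obtain ⟨N, hN⟩ := exists_nat_gt r
    have hN0 : (0 : ℝ) < N := hr.trans_lt hN
    have h1 : d * (r / N) ∈ A := by
      refine h ?_
      have h2 : 0 ≤ r / N := by positivity
      have h3 : r / N ≤ 1 := (div_le_one hN0).2 hN.le
      rw [Set.mem_uIcc]
      rcases le_total 0 d with h0 | h0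
      · exact Or.inl ⟨mul_nonneg h0 h2, by nlinarith⟩
      · exact Or.inr ⟨by nlinarith, mul_nonpos_of_nonpos_of_nonneg h0 h2⟩
    have h4 := A.nsmul_mem h1 N
    rwa [nsmul_eq_mul, mul_left_comm, mul_div_cancel₀ _ hN0.ne'] at h4
  refine (AddSubgroup.eq_top_iff' A).2 fun x => ?_
  have hx : x = d * (x / d) := by field_simp
  rcases le_total 0 (x / d) with h0 | h0
  · rw [hx]
    exact key _ h0
  · have := A.neg_mem (key (-(x / d)) (by linarith))
    rwa [mul_neg, neg_neg, ← hx] at this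

theorem exists_ne_add_of_not_linear {v : ℝ → ℝ} (hv : Continuous v)
    (h : ¬ ∃ m : ℝ, ∀ u, v u = m * u) : ∃ s t, v (s + t) - v s - v t ≠ 0 := by
  by_contra! hadd
  let F : ℝ →+ ℝ := AddMonoidHom.mk' v fun s t => by linarith [hadd s t]
  refine h ⟨v 1, fun u => ?_⟩
  have := map_real_smul F hv u 1
  simpa [F, mul_comm] using this

/-! ### Shears -/

/-- The homeomorphism that reads `(u, z) ↦ (u + s, z + f u)` in the coordinates `φ`. -/
def shear {L : Type*} [TopologicalSpace L] (φ : L ≃ₜ ℝ × ℝ) (s : ℝ) (f : C(ℝ, ℝ)) : L ≃ₜ L where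
  toFun x := φ.symm ((φ x).1 + s, (φ x).2 + f (φ x).1)
  invFun x := φ.symm ((φ x).1 - s, (φ x).2 - f ((φ x).1 - s))
  left_inv x := by simp
  right_inv x := by simp
  continuous_toFun := by fun_prop
  continuous_invFun := by fun_prop

section Shear

variable {L : Type*} [TopologicalSpace L] (φ : L ≃ₜ ℝ × ℝ)

theorem apply_shear (s : ℝ) (f : C(ℝ, ℝ)) (x : L) :
    φ (shear φ s f x) = ((φ x).1 + s, (φ x).2 + f (φ x).1) := by
  simp [shear]

theorem eq_shear {s : ℝ} {f : C(ℝ, ℝ)} {g : L ≃ₜ L}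
    (h : ∀ x, φ (g x) = ((φ x).1 + s, (φ x).2 + f (φ x).1)) : g = shear φ s f := by
  ext x
  exact φ.injective ((h x).trans (apply_shear φ s f x).symm)

theorem shear_congr {s t : ℝ} {f g : C(ℝ, ℝ)} (hs : s = t) (h : ∀ u, f u = g u) :
    shear φ s f = shear φ t g := by
  rw [hs, ContinuousMap.ext h]

theorem shear_mul {s t r : ℝ} {f g F : C(ℝ, ℝ)} (hr : r = s + t)
    (h : ∀ u, F u = g u + f (u + t)) : shear φ s f * shear φ t g = shear φ r F := by
  refine eq_shear φ fun x => ?_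
  rw [Homeomorph.mul_apply, apply_shear, apply_shear, h, hr]
  ext
  · simp only
    ring
  · simp only
    ring

theorem shear_zero : shear φ 0 0 = 1 := by
  refine (eq_shear φ fun x => ?_).symm
  simp

variable {φ} {H : Subgroup (L ≃ₜ L)}

theorem shear_sub_mem {s : ℝ} {f g F : C(ℝ, ℝ)} (hf : shear φ s f ∈ H) (hg : shear φ s g ∈ H)
    (h : ∀ u, F u = f u - g u) : shear φ 0 F ∈ H := by
  have : shear φ 0 F = (shear φ s g)⁻¹ * shear φ s f := by
    rw [eq_inv_mul_iff_mul_eq]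
    exact shear_mul φ (by ring) fun u => by rw [h]; simp
  rw [this]
  exact H.mul_mem (H.inv_mem hg) hf

theorem shear_add_mem {s : ℝ} {f g F : C(ℝ, ℝ)} (hf : shear φ s f ∈ H) (hg : shear φ 0 g ∈ H)
    (h : ∀ u, F u = f u + g u) : shear φ s F ∈ H := by
  rw [← shear_mul φ (s := s) (t := 0) (f := f) (g := g) (by ring) fun u => by rw [h, add_zero, add_comm]]
  exact H.mul_mem hf hg

/-- Conjugating by the translation `shear φ t 0` moves the argument of `f` by `t`. -/
theorem shear_translate_mem (h0 : ∀ s, shear φ s 0 ∈ H) {f F : C(ℝ, ℝ)} (hf : shear φ 0 f ∈ H)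
    (t : ℝ) (h : ∀ u, F u = f (u + t)) : shear φ 0 F ∈ H := by
  refine shear_sub_mem (s := t) (f := F) (g := 0) ?_ (h0 t) (by simp)
  rw [← shear_mul φ (s := 0) (t := t) (f := f) (g := 0) (by ring) (by simpa using h)]
  exact H.mul_mem hf (h0 t)

/-- Composing left translations for `s` and `t` and comparing with the one for `s + t` leaves a
linear shear whose slope is the additivity defect of `v`. These slopes fill an interval, hence `ℝ`.
Linear shears then strip the left translations down to pure `u`-translations, and those strip the
right translations down to multiples of `v`. -/
theorem shear_mul_mem_of_left_right {v : C(ℝ, ℝ)} (hlin : ¬ ∃ m : ℝ, ∀ u, v u = m * u)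
    (hv0 : v 0 = 0)
    (hleft : ∀ s t, ∀ f : C(ℝ, ℝ), (∀ u, f u = t - u * v s) → shear φ s f ∈ H)
    (hright : ∀ s t, ∀ f : C(ℝ, ℝ), (∀ u, f u = t - s * v u) → shear φ s f ∈ H) :
    (∀ c t, ∀ f : C(ℝ, ℝ), (∀ u, f u = c * u + t) → shear φ 0 f ∈ H) ∧
      (∀ s, shear φ s 0 ∈ H) ∧ ∀ r, ∀ f : C(ℝ, ℝ), (∀ u, f u = r * v u) → shear φ 0 f ∈ H := by
  let A : AddSubgroup ℝ :=
    { carrier := {c | ∀ f : C(ℝ, ℝ), (∀ u, f u = c * u) → shear φ 0 f ∈ H}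
      zero_mem' := fun f hf => hleft 0 0 f (by simp [hf, hv0])
      add_mem' := by
        intro a b ha hb f hf
        refine shear_add_mem (ha ⟨fun u => a * u, by fun_prop⟩ fun u => rfl)
          (hb ⟨fun u => b * u, by fun_prop⟩ fun u => rfl) fun u => ?_
        rw [hf, add_mul]
        rfl
      neg_mem' := by
        intro a ha f hf
        refine shear_sub_mem (hleft 0 0 0 (by simp [hv0]))
          (ha ⟨fun u => a * u, by fun_prop⟩ fun u => rfl) fun u => ?_
        rw [hf]
        simp }
  have hdef (s t : ℝ) : v (s + t) - v s - v t ∈ A := by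
    intro f hf
    -- The constant `v s * t` cancels the `-t * v s` produced by the composition, so that only a
    -- linear term remains.
    refine shear_sub_mem (s := s + t) (f := ⟨fun u => v s * t - u * v t - (u + t) * v s, by fun_prop⟩)
      (g := ⟨fun u => 0 - u * v (s + t), by fun_prop⟩) ?_ (hleft _ 0 _ fun u => rfl) fun u => ?_
    · rw [← shear_mul φ (s := s) (t := t) (f := ⟨fun u => v s * t - u * v s, by fun_prop⟩)
        (g := ⟨fun u => 0 - u * v t, by fun_prop⟩) rfl fun u => ?_]
      · exact H.mul_mem (hleft _ _ _ fun u => rfl) (hleft _ _ _ fun u => rfl)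
      · simp only [ContinuousMap.coe_mk]
        ring
    · rw [hf]
      simp only [ContinuousMap.coe_mk]
      ring
  have hA : A = ⊤ := by
    obtain ⟨s, t, hst⟩ := exists_ne_add_of_not_linear v.continuous hlin
    refine A.eq_top_of_uIcc_subset hst fun x hx => ?_
    -- Scaling `(s, t)` by `r` joins the defect `0` to the given nonzero defect.
    have hcont : Continuous fun r : ℝ => v (r * s + r * t) - v (r * s) - v (r * t) := by fun_prop
    have h1 := intermediate_value_uIcc (a := 0) (b := 1) hcont.continuousOn
    simp only [zero_mul, add_zero, hv0, sub_zero, one_mul] at h1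
    obtain ⟨r, -, hr⟩ := h1 hx
    rw [← hr]
    exact hdef _ _
  have haff (c t : ℝ) (f : C(ℝ, ℝ)) (hf : ∀ u, f u = c * u + t) : shear φ 0 f ∈ H := by
    have hc : c ∈ A := hA ▸ AddSubgroup.mem_top c
    refine shear_add_mem (hc ⟨fun u => c * u, by fun_prop⟩ fun u => rfl)
      (hleft 0 t (ContinuousMap.const ℝ t) (by simp [hv0])) hf
  have htr (s : ℝ) : shear φ s 0 ∈ H := by
    refine shear_add_mem (hleft s 0 ⟨fun u => 0 - u * v s, by fun_prop⟩ fun u => rfl)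
      (haff (v s) 0 ⟨fun u => v s * u + 0, by fun_prop⟩ fun u => rfl) fun u => ?_
    simp [mul_comm]
  refine ⟨haff, htr, fun r f hf => ?_⟩
  refine shear_sub_mem (hright (-r) 0 f fun u => ?_) (htr (-r)) (by simp)
  rw [hf]
  ring

theorem shear_degreeLT_mem (h0 : ∀ s, shear φ s 0 ∈ H) {m : ℕ} {p : Polynomial ℝ}
    (hp : p.degree = m) (hpH : ∀ r : ℝ, shear φ 0 (r • p).toContinuousMap ∈ H) {q : Polynomial ℝ}
    (hq : q ∈ Polynomial.degreeLT ℝ (m + 1)) (s : ℝ) : shear φ s q.toContinuousMap ∈ H := by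
  -- Requiring all real multiples in `H` makes `W` a linear subspace, not merely an additive group.
  let W : Submodule ℝ (Polynomial ℝ) :=
    { carrier := {q | ∀ r : ℝ, shear φ 0 (r • q).toContinuousMap ∈ H}
      zero_mem' := fun r => by
        convert h0 0
        ext
        simp
      add_mem' := fun ha hb r => shear_add_mem (ha r) (hb r) fun u => by simp
      smul_mem' := fun c q hq r => by
        rw [smul_smul]
        exact hq _ }
  have hle := Polynomial.degreeLT_le_of_taylor_mem W (fun q hq r =>
    shear_translate_mem h0 (hq r) 1 fun u => by simp [Polynomial.taylor_eval]) m p hpH hp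
  exact shear_add_mem (h0 s) (hle hq 1) fun u => by simp

end Shear

/-! ### Iterated commutators of shears -/

section Commutator

open Polynomial
open scoped commutatorElement

variable {L : Type*} [TopologicalSpace L] (φ : L ≃ₜ ℝ × ℝ)

theorem commutatorElement_shear (s t : ℝ) (p q : ℝ[X]) :
    ⁅shear φ s p.toContinuousMap, shear φ t q.toContinuousMap⁆ =
      shear φ 0 ((taylor (-s) (p - taylor (-t) p)) - taylor (-t) (q - taylor (-s) q)).toContinuousMap := by
  rw [commutatorElement_def, mul_inv_eq_iff_eq_mul, mul_inv_eq_iff_eq_mul,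
    shear_mul φ (r := s + t) (F := (q + taylor t p).toContinuousMap) rfl
      fun u => by simp [taylor_eval],
    mul_assoc, shear_mul φ (r := t + s) (F := (p + taylor s q).toContinuousMap) rfl
      fun u => by simp [taylor_eval]]
  refine (shear_mul φ (by ring) fun u => ?_).symm
  simp only [toContinuousMap_apply, eval_add, eval_sub, taylor_eval]
  ring_nf

/-- The first commutator removes the translation part and leaves degree below `n`; each further one
is a difference and lowers the bound by one. -/
theorem commutatorElement_iterate_shear_mem {n : ℕ} {s t : ℝ} {p q : ℝ[X]}
    (hp : p ∈ degreeLT ℝ (n + 1)) (hq : q ∈ degreeLT ℝ (n + 1)) :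
    ∀ k j, j + k = n → ∃ P ∈ degreeLT ℝ j,
      (fun g => ⁅g, shear φ t q.toContinuousMap⁆)^[k + 1] (shear φ s p.toContinuousMap) =
        shear φ 0 P.toContinuousMap := by
  have htaylor {i : ℕ} {r : ℝ} {P : ℝ[X]} (hP : P ∈ degreeLT ℝ i) : taylor r P ∈ degreeLT ℝ i := by
    rw [mem_degreeLT] at hP ⊢
    rwa [degree_taylor]
  have hdiff {i : ℕ} {r : ℝ} {P : ℝ[X]} (hP : P ∈ degreeLT ℝ (i + 1)) :
      P - taylor r P ∈ degreeLT ℝ i := by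
    rw [← neg_sub]
    exact Submodule.neg_mem _ (taylor_sub_self_mem_degreeLT hP r)
  intro k
  induction k with
  | zero =>
    rintro j rfl
    exact ⟨_, Submodule.sub_mem _ (htaylor (hdiff hp)) (htaylor (hdiff hq)),
      commutatorElement_shear φ s t p q⟩
  | succ k ih =>
    intro j hj
    obtain ⟨P, hP, h⟩ := ih (j + 1) (by omega)
    refine ⟨_, ?_, by rw [Function.iterate_succ_apply', h]; exact commutatorElement_shear φ 0 t P q⟩
    rw [neg_zero, taylor_zero, taylor_zero, sub_self, map_zero, sub_zero]
    exact hdiff hP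

theorem commutatorElement_iterate_shear_eq_one {n : ℕ} {s t : ℝ} {p q : ℝ[X]}
    (hp : p ∈ degreeLT ℝ (n + 1)) (hq : q ∈ degreeLT ℝ (n + 1)) :
    (fun g => ⁅g, shear φ t q.toContinuousMap⁆)^[n + 1] (shear φ s p.toContinuousMap) = 1 := by
  obtain ⟨P, hP, h⟩ := commutatorElement_iterate_shear_mem φ (s := s) (t := t) hp hq n 0 (zero_add n)
  rw [h, ← shear_zero φ]
  refine shear_congr φ rfl fun u => ?_
  rw [mem_degreeLT] at hP
  have : P = 0 := by simpa using hP
  simp [this]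

/-- This turns Engel identities into difference equations for `f`. -/
theorem commutatorElement_iterate_shear_translation (t : ℝ) (f : C(ℝ, ℝ)) (k : ℕ) :
    ∃ F : C(ℝ, ℝ), (F : ℝ → ℝ) = (-1 : ℝ) ^ k • (fwdDiff t)^[k] f ∧
      (fun g => ⁅g, shear φ (-t) 0⁆)^[k] (shear φ 0 f) = shear φ 0 F := by
  induction k with
  | zero => exact ⟨f, by simp, rfl⟩
  | succ k ih =>
    obtain ⟨F, hF, h⟩ := ih
    refine ⟨⟨fun u => F u - F (u + t), by fun_prop⟩, ?_, ?_⟩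
    · rw [Function.iterate_succ_apply']
      funext u
      simp only [ContinuousMap.coe_mk, hF, Pi.smul_apply, fwdDiff, smul_eq_mul]
      ring
    · rw [Function.iterate_succ_apply', h, commutatorElement_def, mul_inv_eq_iff_eq_mul,
        mul_inv_eq_iff_eq_mul, shear_mul φ (r := -t) (F := ⟨fun u => F (u - t), by fun_prop⟩)
        (by ring) (fun u => by simp [sub_eq_add_neg]), mul_assoc,
        shear_mul φ (r := -t) (F := F) (by ring) (fun u => by simp)]
      refine (shear_mul φ (by ring) fun u => ?_).symm
      simp [sub_eq_add_neg]

theorem fwdDiff_iter_eq_zero_of_commutatorElement {t : ℝ} {f : C(ℝ, ℝ)} {k : ℕ}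
    (h : (fun g => ⁅g, shear φ (-t) 0⁆)^[k] (shear φ 0 f) = 1) : (fwdDiff t)^[k] f = 0 := by
  obtain ⟨F, hF, h1⟩ := commutatorElement_iterate_shear_translation φ t f k
  rw [h1] at h
  have hF0 : (F : ℝ → ℝ) = 0 := by
    funext u
    have := apply_shear φ 0 F (φ.symm (u, 0))
    rw [h] at this
    simpa using (congrArg Prod.snd this).symm
  rw [hF0] at hF
  have h2 : ((-1 : ℝ) ^ k) ≠ 0 := by simp
  exact (smul_eq_zero_iff_right h2).1 hF.symm

end Commutator

/-! ### Groups of homeomorphisms -/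

namespace Homeomorph

variable {X A : Type*} [TopologicalSpace X] [TopologicalSpace A]

theorem continuous_of_continuous_uncurry (T : A → X ≃ₜ X)
    (h : Continuous fun p : A × X => T p.1 p.2)
    (h' : Continuous fun p : A × X => (T p.1).symm p.2) : Continuous T := by
  refine continuous_induced_rng.2 (Continuous.prodMk ?_ ?_)
  · exact ContinuousMap.continuous_of_continuous_uncurry _ h
  · exact ContinuousMap.continuous_of_continuous_uncurry _ h'

theorem continuous_toContinuousMap :
    Continuous fun g : X ≃ₜ X => (⟨g, g.continuous⟩ : C(X, X)) :=
  continuous_fst.comp (continuous_induced_dom (f := fun f : X ≃ₜ X =>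
    ((⟨f, f.continuous⟩ : C(X, X)), (⟨f.symm, f.symm.continuous⟩ : C(X, X)))))

theorem continuous_eval_const (x : X) : Continuous fun g : X ≃ₜ X => g x :=
  (ContinuousEvalConst.continuous_eval_const (F := C(X, X)) x).comp continuous_toContinuousMap

theorem t2Space_homeomorph [T2Space X] : T2Space (X ≃ₜ X) :=
  T2Space.of_injective_continuous (f := fun g : X ≃ₜ X => (⟨g, g.continuous⟩ : C(X, X)))
    (fun _ _ h => Homeomorph.ext fun x => congrArg (fun f : C(X, X) => f x) h)
    continuous_toContinuousMap

end Homeomorph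

theorem subset_topologicallyGenerated {X : Type*} [TopologicalSpace X] (S : Set (X ≃ₜ X)) :
    S ⊆ topologicallyGenerated S := fun g hg => by
  refine Subgroup.mem_sInf.2 fun H hH => hH.2 hg

theorem topologicallyGenerated_le {X : Type*} [TopologicalSpace X] {S : Set (X ≃ₜ X)}
    {H : Subgroup (X ≃ₜ X)} (hc : IsClosed (H : Set (X ≃ₜ X))) (h : S ⊆ H) :
    topologicallyGenerated S ≤ H := sInf_le ⟨hc, h⟩

theorem isClosed_topologicallyGenerated {X : Type*} [TopologicalSpace X] (S : Set (X ≃ₜ X)) :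
    IsClosed (topologicallyGenerated S : Set (X ≃ₜ X)) := by
  rw [topologicallyGenerated, Subgroup.coe_sInf]
  exact isClosed_biInter fun H hH => hH.1

/-! ### The filiform groups as groups of shears -/

namespace Filiform

open Matrix Polynomial
open scoped commutatorElement

theorem homeomorph_mul {n : ℕ} (hn : 1 ≤ n) (g h : group n) :
    homeomorph hn (g * h) = ((homeomorph hn g).1 + (homeomorph hn h).1,
      (homeomorph hn h).2 + (homeomorph hn g).2 ᵥ* shift n (homeomorph hn h).1) := by
  obtain ⟨p, rfl⟩ := (homeomorph hn).symm.surjective g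
  obtain ⟨q, rfl⟩ := (homeomorph hn).symm.surjective h
  simp only [Homeomorph.apply_symm_apply]
  rw [← Homeomorph.eq_symm_apply]
  ext1
  ext1
  exact elt_mul n p.1 q.1 p.2 q.2

/-- The polynomial with the coefficients `a`. -/
noncomputable def toPolynomial (n : ℕ) (a : Fin (n + 1) → ℝ) : ℝ[X] :=
  ((degreeLTEquiv ℝ (n + 1)).symm a : degreeLT ℝ (n + 1))

theorem toPolynomial_mem (n : ℕ) (a : Fin (n + 1) → ℝ) :
    toPolynomial n a ∈ degreeLT ℝ (n + 1) := ((degreeLTEquiv ℝ (n + 1)).symm a).2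

theorem exists_toPolynomial_eq {n : ℕ} {p : ℝ[X]} (hp : p ∈ degreeLT ℝ (n + 1)) :
    ∃ a, toPolynomial n a = p :=
  ⟨degreeLTEquiv ℝ (n + 1) ⟨p, hp⟩, by simp [toPolynomial]⟩

theorem toPolynomial_injective (n : ℕ) : Function.Injective (toPolynomial n) :=
  Subtype.val_injective.comp (degreeLTEquiv ℝ (n + 1)).symm.injective

theorem eval_toPolynomial (n : ℕ) (a : Fin (n + 1) → ℝ) (u : ℝ) :
    (toPolynomial n a).eval u = ∑ j, a j * u ^ (j : ℕ) := by
  rw [eval_eq_sum_degreeLTEquiv (toPolynomial_mem n a)]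
  simp [toPolynomial]

/-- Row `k` of `shift n d` lists the coefficients of `(u - d) ^ k`; this matches matrix
multiplication with composition of shears. -/
theorem eval_toPolynomial_vecMul_shift (n : ℕ) (a : Fin (n + 1) → ℝ) (d u : ℝ) :
    (toPolynomial n (a ᵥ* shift n d)).eval u = (toPolynomial n a).eval (u - d) := by
  simp only [eval_toPolynomial, vecMul, dotProduct, Finset.sum_mul]
  rw [Finset.sum_comm]
  refine Finset.sum_congr rfl fun k _ => ?_
  rw [sub_eq_add_neg, add_pow, Finset.mul_sum]
  have hk : (k : ℕ) + 1 ≤ n + 1 := k.2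
  rw [Finset.sum_subset (Finset.range_mono hk), Finset.sum_range]
  · refine Finset.sum_congr rfl fun j _ => ?_
    simp only [shift, of_apply]
    ring
  · intro j _ hj
    have : (k : ℕ) < j := by simpa using hj
    simp [Nat.choose_eq_zero_of_lt this]

section

variable {L : Type*} [TopologicalSpace L] {n : ℕ} (hn : 1 ≤ n) (φ : L ≃ₜ ℝ × ℝ)

/-- The filiform group acting by shears whose second component is a polynomial. -/
noncomputable def toShear : group n →* (L ≃ₜ L) where
  toFun g := shear φ (-(homeomorph hn g).1)
    (toPolynomial n (homeomorph hn g).2).toContinuousMap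
  map_one' := by
    have h1 : (1 : group n) = (homeomorph hn).symm 0 := by
      ext1
      ext1
      exact (elt_zero n).symm
    rw [h1, Homeomorph.apply_symm_apply, ← shear_zero φ]
    exact shear_congr φ neg_zero fun u => by simp [eval_toPolynomial]
  map_mul' g h := by
    refine (shear_mul φ ?_ fun u => ?_).symm
    · rw [homeomorph_mul]
      ring
    · simp only [homeomorph_mul, toContinuousMap_apply, ← sub_eq_add_neg,
        ← eval_toPolynomial_vecMul_shift]
      simp only [eval_toPolynomial, Pi.add_apply, add_mul, Finset.sum_add_distrib]

theorem mem_range_toShear {g : L ≃ₜ L} :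
    g ∈ (toShear hn φ).range ↔ ∃ s, ∃ p ∈ degreeLT ℝ (n + 1), g = shear φ s p.toContinuousMap := by
  constructor
  · rintro ⟨x, rfl⟩
    exact ⟨_, _, toPolynomial_mem _ _, rfl⟩
  · rintro ⟨s, p, hp, rfl⟩
    obtain ⟨a, rfl⟩ := exists_toPolynomial_eq hp
    refine ⟨(homeomorph hn).symm (-s, a), ?_⟩
    change shear φ _ _ = _
    simp

theorem continuous_toShear : Continuous (toShear hn φ) := by
  have h (p : group n × L) (x : ℝ) : ((toPolynomial n (homeomorph hn p.1).2).toContinuousMap : ℝ → ℝ) x =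
      ∑ j, (homeomorph hn p.1).2 j * x ^ (j : ℕ) := eval_toPolynomial _ _ _
  refine Homeomorph.continuous_of_continuous_uncurry _ ?_ ?_
  · change Continuous fun p : group n × L =>
      φ.symm ((φ p.2).1 + -(homeomorph hn p.1).1, (φ p.2).2 +
        (toPolynomial n (homeomorph hn p.1).2).toContinuousMap (φ p.2).1)
    simp only [h]
    fun_prop
  · change Continuous fun p : group n × L =>
      φ.symm ((φ p.2).1 - -(homeomorph hn p.1).1, (φ p.2).2 -
        (toPolynomial n (homeomorph hn p.1).2).toContinuousMap ((φ p.2).1 - -(homeomorph hn p.1).1))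
    simp only [h]
    fun_prop

/-- A polynomial of degree at most `n` is recovered linearly from its values at `0, …, n`, and
evaluation at a point is continuous on homeomorphisms. The continuous inverse makes the image closed
and the isomorphism onto it topological. -/
theorem exists_continuous_leftInverse_toShear :
    ∃ R : (L ≃ₜ L) → group n, Continuous R ∧ Function.LeftInverse R (toShear hn φ) := by
  let T : (Fin (n + 1) → ℝ) →ₗ[ℝ] (Fin (n + 1) → ℝ) :=
    LinearMap.pi fun i => (leval (i : ℝ)).comp
      ((degreeLT ℝ (n + 1)).subtype.comp (degreeLTEquiv ℝ (n + 1)).symm.toLinearMap)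
  have hT (a) (i) : T a i = (toPolynomial n a).eval ((i : ℕ) : ℝ) := rfl
  have hTinj : LinearMap.ker T = ⊥ := by
    refine LinearMap.ker_eq_bot'.2 fun a ha => toPolynomial_injective n ?_
    have h0 : toPolynomial n 0 = 0 := by simp [toPolynomial]
    rw [h0]
    refine eq_zero_of_degree_lt_of_eval_index_eq_zero (s := Finset.univ)
      (v := fun i : Fin (n + 1) => ((i : ℕ) : ℝ)) ?_ ?_ fun i _ => ?_
    · intro i _ j _ hij
      exact Fin.ext (Nat.cast_injective (R := ℝ) hij)
    · simpa using mem_degreeLT.1 (toPolynomial_mem n a)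
    · rw [← hT, ha]
      rfl
  obtain ⟨S, hS⟩ := T.exists_leftInverse_of_injective hTinj
  refine ⟨fun g => (homeomorph hn).symm (-(φ (g (φ.symm (0, 0)))).1,
    S fun i : Fin (n + 1) => (φ (g (φ.symm (((i : ℕ) : ℝ), 0)))).2), ?_, fun x => ?_⟩
  · have hev (x : L) : Continuous fun g : L ≃ₜ L => φ (g x) :=
      φ.continuous.comp (Homeomorph.continuous_eval_const x)
    refine (homeomorph hn).symm.continuous.comp (Continuous.prodMk (hev _).fst.neg ?_)
    exact S.continuous_of_finiteDimensional.comp (continuous_pi fun i => (hev _).snd)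
  · rw [Homeomorph.symm_apply_eq]
    change (-(φ (shear φ _ _ _)).1, S fun i : Fin (n + 1) => (φ (shear φ _ _ _)).2) = _
    simp only [apply_shear, Homeomorph.apply_symm_apply, zero_add, neg_neg, toContinuousMap_apply]
    refine Prod.ext rfl ?_
    exact LinearMap.congr_fun hS (homeomorph hn x).2

theorem isClosed_range_toShear [T2Space L] :
    IsClosed ((toShear hn φ).range : Set (L ≃ₜ L)) := by
  obtain ⟨R, hR, hleft⟩ := exists_continuous_leftInverse_toShear hn φ
  have := Homeomorph.t2Space_homeomorph (X := L)
  have h : ((toShear hn φ).range : Set (L ≃ₜ L)) = {g | g = toShear hn φ (R g)} := by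
    ext g
    constructor
    · rintro ⟨x, rfl⟩
      exact congrArg (toShear hn φ) (hleft x).symm
    · intro hg
      exact ⟨R g, hg.symm⟩
  rw [h]
  exact isClosed_eq continuous_id ((continuous_toShear hn φ).comp hR)

theorem nonempty_continuousMulEquiv_range_toShear :
    Nonempty ((toShear hn φ).range ≃ₜ* group n) := by
  obtain ⟨R, hR, hleft⟩ := exists_continuous_leftInverse_toShear hn φ
  let e : group n ≃* (toShear hn φ).range := MulEquiv.ofBijective (toShear hn φ).rangeRestrict
    ⟨MonoidHom.rangeRestrict_injective_iff.2 hleft.injective, MonoidHom.rangeRestrict_surjective _⟩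
  exact ⟨ContinuousMulEquiv.symm
    { e with
      continuous_toFun := (continuous_toShear hn φ).subtype_mk _
      continuous_invFun := by
        refine (hR.comp continuous_subtype_val).congr fun x => ?_
        obtain ⟨y, rfl⟩ := (toShear hn φ).rangeRestrict_surjective x
        exact (hleft y).trans (e.symm_apply_apply y).symm }⟩

end

theorem commutatorElement_iterate_eq_one {n : ℕ} (hn : 1 ≤ n) (x y : group n) :
    (fun g => ⁅g, y⁆)^[n + 1] x = 1 := by
  let φ : ℝ × ℝ ≃ₜ ℝ × ℝ := Homeomorph.refl _
  obtain ⟨R, -, hleft⟩ := exists_continuous_leftInverse_toShear hn φ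
  refine hleft.injective ?_
  rw [map_one, Function.Semiconj.iterate_right (f := toShear hn φ)
    (gb := fun g => ⁅g, toShear hn φ y⁆) (fun g => map_commutatorElement _ g y)]
  exact commutatorElement_iterate_shear_eq_one φ (toPolynomial_mem _ _) (toPolynomial_mem _ _)

/-- The `n`-th difference of `u ^ n` with step `1` is `n!`. -/
theorem exists_commutatorElement_iterate_ne_one {n : ℕ} (hn : 1 ≤ n) :
    ∃ x y : group n, (fun g => ⁅g, y⁆)^[n] x ≠ 1 := by
  let φ : ℝ × ℝ ≃ₜ ℝ × ℝ := Homeomorph.refl _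
  obtain ⟨x, hx⟩ := (mem_range_toShear hn φ).2 ⟨0, X ^ n, by
    rw [mem_degreeLT, degree_X_pow]; exact_mod_cast n.lt_succ_self, rfl⟩
  obtain ⟨y, hy⟩ := (mem_range_toShear hn φ).2 ⟨-1, 0, Submodule.zero_mem _, rfl⟩
  refine ⟨x, y, fun h => ?_⟩
  have h1 := congrArg (toShear hn φ) h
  rw [map_one, Function.Semiconj.iterate_right (f := toShear hn φ)
    (gb := fun g => ⁅g, toShear hn φ y⁆) (fun g => map_commutatorElement _ g y), hx, hy,
    show (0 : ℝ[X]).toContinuousMap = 0 by ext; simp] at h1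
  have h2 := congrFun (fwdDiff_iter_eq_zero_of_commutatorElement φ h1) 0
  have h3 : ((X ^ n : ℝ[X]).toContinuousMap : ℝ → ℝ) = fun r => r ^ n := by
    ext
    simp
  rw [h3, fwdDiff_iter_eq_factorial] at h2
  exact Nat.cast_ne_zero.2 n.factorial_ne_zero h2

theorem eq_of_mulEquiv {m n : ℕ} (hm : 1 ≤ m) (hn : 1 ≤ n) (e : group m ≃* group n) : m = n := by
  have key {i j : ℕ} (hi : 1 ≤ i) (hj : 1 ≤ j) (f : group i ≃* group j) : i ≤ j := by
    by_contra! hlt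
    obtain ⟨x, y, hxy⟩ := exists_commutatorElement_iterate_ne_one hi
    obtain ⟨k, rfl⟩ := Nat.exists_eq_add_of_le' hlt
    refine hxy (f.injective ?_)
    rw [map_one, Function.Semiconj.iterate_right (f := f)
      (gb := fun g => ⁅g, f y⁆) (fun g => map_commutatorElement f g y),
      Function.iterate_add_apply, commutatorElement_iterate_eq_one hj]
    exact Function.iterate_fixed (commutatorElement_one_left (f y)) k
  exact le_antisymm (key hm hn e) (key hn hm e.symm)

end Filiform

/-! ### The multiplication group -/

section MultiplicationGroup

variable {L : Type*} [TopologicalSpace L] [Loop L] [IsTopologicalLoop L] {φ : L ≃ₜ ℝ × ℝ}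
  {v : ℝ → ℝ}

theorem leftTranslation_eq_shear
    (hφ : ∀ x y : L, φ (x * y) = ((φ x).1 + (φ y).1, (φ x).2 + (φ y).2 - (φ y).1 * v (φ x).1))
    (a : L) {f : C(ℝ, ℝ)} (hf : ∀ u, f u = (φ a).2 - u * v (φ a).1) :
    Loop.leftTranslation a = shear φ (φ a).1 f := by
  refine eq_shear φ fun x => ?_
  change φ (a * x) = _
  rw [hφ, hf]
  ext
  · exact add_comm _ _
  · simp only
    ring

theorem rightTranslation_eq_shear
    (hφ : ∀ x y : L, φ (x * y) = ((φ x).1 + (φ y).1, (φ x).2 + (φ y).2 - (φ y).1 * v (φ x).1))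
    (a : L) {f : C(ℝ, ℝ)} (hf : ∀ u, f u = (φ a).2 - (φ a).1 * v u) :
    Loop.rightTranslation a = shear φ (φ a).1 f := by
  refine eq_shear φ fun x => ?_
  change φ (x * a) = _
  rw [hφ, hf]
  ext
  · rfl
  · simp only
    ring

theorem shear_mem_multiplicationGroup
    (hφ : ∀ x y : L, φ (x * y) = ((φ x).1 + (φ y).1, (φ x).2 + (φ y).2 - (φ y).1 * v (φ x).1))
    (hv : Continuous v) (hlin : ¬ ∃ m : ℝ, ∀ u, v u = m * u) (hv0 : v 0 = 0) :
    (∀ s, shear φ s 0 ∈ multiplicationGroup L) ∧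
      ∀ r, ∀ f : C(ℝ, ℝ), (∀ u, f u = r * v u) → shear φ 0 f ∈ multiplicationGroup L := by
  refine (shear_mul_mem_of_left_right (v := ⟨v, hv⟩) hlin hv0 (fun s t f hf => ?_)
    fun s t f hf => ?_).2
  · have := leftTranslation_eq_shear hφ (φ.symm (s, t)) (f := f) (by simpa using hf)
    rw [φ.apply_symm_apply] at this
    rw [← this]
    exact subset_topologicallyGenerated _ (Or.inl ⟨_, rfl⟩)
  · have := rightTranslation_eq_shear hφ (φ.symm (s, t)) (f := f) (by simpa using hf)
    rw [φ.apply_symm_apply] at this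
    rw [← this]
    exact subset_topologicallyGenerated _ (Or.inr ⟨_, rfl⟩)

open Polynomial

theorem two_le_natDegree_of_not_linear {p : ℝ[X]} (hlin : ¬ ∃ m : ℝ, ∀ u, p.eval u = m * u)
    (hp0 : p.eval 0 = 0) : 2 ≤ p.natDegree := by
  by_contra! h
  refine hlin ⟨p.coeff 1, fun u => ?_⟩
  rw [eq_X_add_C_of_natDegree_le_one (Nat.le_of_lt_succ h)] at hp0 ⊢
  simp at hp0
  simp [hp0]

/-- `Mult(L)` is exactly the group of shears by polynomials of degree at most that of `p`: this
closed group contains the translations, and the translates of multiples of `p` generate it together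
with the `u`-translations. -/
theorem nonempty_multiplicationGroup_continuousMulEquiv [T2Space L] {p : ℝ[X]}
    (hφ : ∀ x y : L,
      φ (x * y) = ((φ x).1 + (φ y).1, (φ x).2 + (φ y).2 - (φ y).1 * p.eval (φ x).1))
    (hlin : ¬ ∃ m : ℝ, ∀ u, p.eval u = m * u) (hp0 : p.eval 0 = 0) :
    Nonempty (multiplicationGroup L ≃ₜ* Filiform.group p.natDegree) := by
  have h2 := two_le_natDegree_of_not_linear hlin hp0
  have h1 : 1 ≤ p.natDegree := by omega
  have heq : multiplicationGroup L = (Filiform.toShear h1 φ).range := by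
    have hp : p ∈ degreeLT ℝ (p.natDegree + 1) := by
      rw [mem_degreeLT]
      exact degree_le_natDegree.trans_lt (by exact_mod_cast p.natDegree.lt_succ_self)
    have hmono {k : ℕ} (hk : k ≤ 1) : (X ^ k : ℝ[X]) ∈ degreeLT ℝ (p.natDegree + 1) := by
      rw [mem_degreeLT, degree_X_pow]
      exact_mod_cast (by omega : k < p.natDegree + 1)
    refine le_antisymm (topologicallyGenerated_le (Filiform.isClosed_range_toShear h1 φ) ?_) ?_
    · rintro _ (⟨a, rfl⟩ | ⟨a, rfl⟩)
      · refine (Filiform.mem_range_toShear h1 φ).2 ⟨(φ a).1,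
          (φ a).2 • X ^ 0 - p.eval (φ a).1 • X ^ 1, ?_, leftTranslation_eq_shear (v := fun u => p.eval u) hφ a fun u => ?_⟩
        · exact Submodule.sub_mem _ (Submodule.smul_mem _ _ (hmono zero_le_one))
            (Submodule.smul_mem _ _ (hmono le_rfl))
        · simp [mul_comm]
      · refine (Filiform.mem_range_toShear h1 φ).2 ⟨(φ a).1,
          (φ a).2 • X ^ 0 - (φ a).1 • p, ?_, rightTranslation_eq_shear (v := fun u => p.eval u) hφ a fun u => ?_⟩
        · exact Submodule.sub_mem _ (Submodule.smul_mem _ _ (hmono zero_le_one))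
            (Submodule.smul_mem _ _ hp)
        · simp
    · intro g hg
      obtain ⟨s, q, hq, rfl⟩ := (Filiform.mem_range_toShear h1 φ).1 hg
      obtain ⟨h0, hpH⟩ := shear_mem_multiplicationGroup hφ p.continuous hlin hp0
      refine shear_degreeLT_mem h0 (degree_eq_natDegree ?_) (fun r => hpH r _ fun u => ?_) hq s
      · rintro rfl
        simp at h1
      · simp
  rw [heq]
  exact Filiform.nonempty_continuousMulEquiv_range_toShear h1 φ

open scoped commutatorElement in
theorem exists_polynomial_of_multiplicationGroup_mulEquiv {n : ℕ} (hn : 1 ≤ n)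
    (hφ : ∀ x y : L, φ (x * y) = ((φ x).1 + (φ y).1, (φ x).2 + (φ y).2 - (φ y).1 * v (φ x).1))
    (hv : Continuous v) (hlin : ¬ ∃ m : ℝ, ∀ u, v u = m * u) (hv0 : v 0 = 0)
    (e : multiplicationGroup L ≃* Filiform.group n) : ∃ p : ℝ[X], ∀ u, v u = p.eval u := by
  obtain ⟨h0, hvH⟩ := shear_mem_multiplicationGroup hφ hv hlin hv0
  refine exists_polynomial_eval_of_fwdDiff_iter_eq_zero v hv (n + 1) fun s => ?_
  let x : multiplicationGroup L := ⟨shear φ 0 ⟨v, hv⟩, hvH 1 _ fun u => (one_mul _).symm⟩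
  let y : multiplicationGroup L := ⟨shear φ (-s) 0, h0 (-s)⟩
  have h1 : (fun g => ⁅g, y⁆)^[n + 1] x = 1 := by
    refine e.injective ?_
    rw [map_one, Function.Semiconj.iterate_right (f := e)
      (gb := fun g => ⁅g, e y⁆) (fun g => map_commutatorElement e g y)]
    exact Filiform.commutatorElement_iterate_eq_one hn _ _
  have h2 := congrArg (multiplicationGroup L).subtype h1
  rw [map_one, Function.Semiconj.iterate_right (f := (multiplicationGroup L).subtype)
    (gb := fun g => ⁅g, (multiplicationGroup L).subtype y⁆)
    (fun g => map_commutatorElement _ g y)] at h2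
  exact fwdDiff_iter_eq_zero_of_commutatorElement φ (f := ⟨v, hv⟩) h2

theorem multiplicationGroup_equiv_filiform_iff [T2Space L] (hv : Continuous v)
    (hlin : ¬ ∃ m : ℝ, ∀ u, v u = m * u) (hv0 : v 0 = 0) (hL : HasMultiplication L v)
    {n : ℕ} (hn : 1 < n) :
    Nonempty (multiplicationGroup L ≃ₜ* Filiform.group n) ↔
      ∃ a : ℕ → ℝ, a n ≠ 0 ∧
        ∀ u : ℝ, v u = ∑ k ∈ Finset.Icc 1 n, (-1) ^ (k + 1) * a k * u ^ k := by
  obtain ⟨φ, hφ⟩ := hL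
  constructor
  · rintro ⟨e⟩
    obtain ⟨p, hp⟩ :=
      exists_polynomial_of_multiplicationGroup_mulEquiv hn.le hφ hv hlin hv0 e.toMulEquiv
    obtain rfl : v = fun u => p.eval u := funext hp
    obtain ⟨e'⟩ := nonempty_multiplicationGroup_continuousMulEquiv hφ hlin hv0
    have hdeg : p.natDegree = n := Filiform.eq_of_mulEquiv
      (one_le_two.trans (two_le_natDegree_of_not_linear hlin hv0)) hn.le
      (e'.symm.toMulEquiv.trans e.toMulEquiv)
    -- The sign squares away in the required formula; the constant term is absent because `v 0 = 0`.
    refine ⟨fun k => (-1) ^ (k + 1) * p.coeff k, ?_, fun u => ?_⟩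
    · refine mul_ne_zero (by simp) ?_
      rw [← hdeg]
      refine leadingCoeff_ne_zero.2 ?_
      rintro rfl
      simp at hdeg
      omega
    · have hc : p.coeff 0 = 0 := by rwa [coeff_zero_eq_eval_zero]
      simp only
      rw [eval_eq_sum_range, hdeg, Finset.sum_range_succ', hc, zero_mul, add_zero,
        Finset.range_eq_Ico, Finset.sum_Ico_add' (fun k => p.coeff k * u ^ k), zero_add,
        Finset.Ico_add_one_right_eq_Icc]
      refine Finset.sum_congr rfl fun k _ => ?_
      rw [← mul_assoc ((-1 : ℝ) ^ (k + 1)), ← mul_pow]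
      simp
  · rintro ⟨a, ha, hva⟩
    let p : ℝ[X] := ∑ k ∈ Finset.Icc 1 n, C ((-1) ^ (k + 1) * a k) * X ^ k
    obtain rfl : v = fun u => p.eval u := by
      funext u
      rw [hva, eval_finsetSum]
      simp
    have hcoeff : p.coeff n = (-1) ^ (n + 1) * a n := by
      simp only [p, finsetSum_coeff, coeff_C_mul_X_pow]
      rw [Finset.sum_ite_eq]
      simp [hn.le]
    have hdeg : p.natDegree = n := by
      refine le_antisymm (natDegree_sum_le_of_forall_le _ _ fun k hk => ?_)
        (le_natDegree_of_ne_zero ?_)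
      · exact (natDegree_C_mul_X_pow_le _ _).trans (Finset.mem_Icc.1 hk).2
      · rw [hcoeff]
        exact mul_ne_zero (by simp) ha
    rw [← hdeg]
    exact nonempty_multiplicationGroup_continuousMulEquiv hφ hlin hv0

end MultiplicationGroup

/-! ### Subgroups of the Heisenberg group -/

/-- The coordinates `(x, y, w)` identify `G` with the Heisenberg group. -/
def IsHeisenbergChart {G : Type*} [Group G] [TopologicalSpace G] (ψ : G ≃ₜ ℝ × ℝ × ℝ) : Prop :=
  ∀ g h : G, ψ (g * h) = ((ψ g).1 + (ψ h).1, (ψ g).2.1 + (ψ h).2.1,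
    (ψ g).2.2 + (ψ h).2.2 - (ψ g).2.1 * (ψ h).1)

theorem Filiform.exists_isHeisenbergChart {G : Type*} [Group G] [TopologicalSpace G]
    (e : G ≃ₜ* Filiform.group 1) : ∃ ψ : G ≃ₜ ℝ × ℝ × ℝ, IsHeisenbergChart ψ := by
  let swap : (Fin (1 + 1) → ℝ) ≃ₜ ℝ × ℝ :=
    { toFun := fun a => (a 1, a 0)
      invFun := fun q => ![q.2, q.1]
      left_inv := fun a => by
        ext i
        fin_cases i <;> rfl
      right_inv := fun q => rfl
      continuous_toFun := by fun_prop
      continuous_invFun := by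
        refine continuous_pi fun i => ?_
        fin_cases i
        · exact continuous_snd
        · exact continuous_fst }
  refine ⟨e.toHomeomorph.trans ((Filiform.homeomorph le_rfl).trans
    ((Homeomorph.refl ℝ).prodCongr swap)), fun g h => ?_⟩
  have key := Filiform.homeomorph_mul le_rfl (e g) (e h)
  rw [← map_mul] at key
  have h1 (a : Fin (1 + 1) → ℝ) (d : ℝ) : Matrix.vecMul a (Filiform.shift 1 d) =
      ![a 0 - a 1 * d, a 1] := by
    ext i
    fin_cases i <;>
      simp [Matrix.vecMul, dotProduct, Filiform.shift, Fin.sum_univ_succ, sub_eq_add_neg]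
  rw [h1] at key
  change ((Homeomorph.refl ℝ).prodCongr swap) (Filiform.homeomorph le_rfl (e (g * h))) = _
  rw [key]
  refine Prod.ext rfl (Prod.ext ?_ ?_)
  · exact add_comm _ _
  · have h2 (a b d : ℝ) (c : ℝ) : a + (b - c * d) = b + a - c * d := by ring
    exact h2 _ _ _ _

namespace IsHeisenbergChart

variable {G : Type*} [Group G] [TopologicalSpace G] {ψ : G ≃ₜ ℝ × ℝ × ℝ}

theorem map_one (hψ : IsHeisenbergChart ψ) : ψ 1 = 0 := by
  have h := hψ 1 1
  rw [mul_one] at h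
  have h1 : (ψ 1).1 = 0 := by linarith [congrArg Prod.fst h]
  have h2 : (ψ 1).2.1 = 0 := by linarith [congrArg (fun q => q.2.1) h]
  have h3 : (ψ 1).2.2 = 0 := by
    have := congrArg (fun q => q.2.2) h
    simp only [h1, mul_zero, sub_zero] at this
    linarith
  exact Prod.ext h1 (Prod.ext h2 h3)

/-- The chart after a change of coordinates that turns the one-parameter group through `k`
into a coordinate axis. -/
theorem exists_isHeisenbergChart_axis (hψ : IsHeisenbergChart ψ) (k : G)
    (hk : (ψ k).1 ^ 2 + (ψ k).2.1 ^ 2 ≠ 0) :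
    ∃ ψ' : G ≃ₜ ℝ × ℝ × ℝ, IsHeisenbergChart ψ' ∧ ψ' k = (0, 1, 0) ∧
      (∀ g, (ψ' g).1 = (ψ k).2.1 * (ψ g).1 - (ψ k).1 * (ψ g).2.1) ∧
      ∀ g, (ψ' g).1 = 0 → (ψ' g).2.1 = 0 → (ψ g).1 = 0 ∧ (ψ g).2.1 = 0 := by
  obtain ⟨a, ha⟩ : ∃ a, a = (ψ k).1 := ⟨_, rfl⟩
  obtain ⟨b, hb⟩ : ∃ b, b = (ψ k).2.1 := ⟨_, rfl⟩
  obtain ⟨N, hN⟩ : ∃ N, N = a ^ 2 + b ^ 2 := ⟨_, rfl⟩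
  obtain ⟨w, hw⟩ : ∃ w, w = (ψ k).2.2 + a * b / 2 := ⟨_, rfl⟩
  rw [← ha, ← hb] at hk
  rw [← hN] at hk
  let s : ℝ × ℝ × ℝ → ℝ := fun q => b * q.1 - a * q.2.1
  let p : ℝ × ℝ × ℝ → ℝ := fun q => (a * q.1 + b * q.2.1) / N
  let x : ℝ × ℝ × ℝ → ℝ := fun q => b * q.1 / N + a * q.2.1
  let y : ℝ × ℝ × ℝ → ℝ := fun q => -a * q.1 / N + b * q.2.1
  have hx (q : ℝ × ℝ × ℝ) (r : ℝ) : x (s q, p q, r) = q.1 := by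
    simp only [x, s, p]
    field_simp
    rw [hN]
    ring
  have hy (q : ℝ × ℝ × ℝ) (r : ℝ) : y (s q, p q, r) = q.2.1 := by
    simp only [y, s, p]
    field_simp
    rw [hN]
    ring
  have hs (q : ℝ × ℝ × ℝ) (r : ℝ) : s (x q, y q, r) = q.1 := by
    simp only [x, y, s]
    field_simp
    rw [hN]
    ring
  have hp (q : ℝ × ℝ × ℝ) (r : ℝ) : p (x q, y q, r) = q.2.1 := by
    simp only [x, y, p]
    field_simp
    rw [hN]
    ring
  have hsp (q q' : ℝ × ℝ × ℝ) : s q * p q' - p q * s q' = q.1 * q'.2.1 - q.2.1 * q'.1 := by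
    simp only [s, p]
    field_simp
    rw [hN]
    ring
  let T : ℝ × ℝ × ℝ ≃ₜ ℝ × ℝ × ℝ :=
    { toFun := fun q => (s q, p q, q.2.2 + q.1 * q.2.1 / 2 - w * p q - s q * p q / 2)
      invFun := fun q => (x q, y q, q.2.2 - x q * y q / 2 + w * q.2.1 + q.1 * q.2.1 / 2)
      left_inv := fun q => by
        simp only [hx, hy]
        refine Prod.ext rfl (Prod.ext rfl ?_)
        simp only
        ring
      right_inv := fun q => by
        simp only [hs, hp]
        refine Prod.ext rfl (Prod.ext rfl ?_)
        simp only
        ring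
      continuous_toFun := by
        simp only [s, p]
        fun_prop
      continuous_invFun := by
        simp only [x, y]
        fun_prop }
  have hT (g : G) : (ψ.trans T) g = (s (ψ g), p (ψ g),
    (ψ g).2.2 + (ψ g).1 * (ψ g).2.1 / 2 - w * p (ψ g) - s (ψ g) * p (ψ g) / 2) := rfl
  refine ⟨ψ.trans T, fun g h => ?_, ?_, fun g => ?_, fun g h1 h2 => ?_⟩
  · have hsa : s (ψ (g * h)) = s (ψ g) + s (ψ h) := by
      rw [hψ]
      simp only [s]
      ring
    have hpa : p (ψ (g * h)) = p (ψ g) + p (ψ h) := by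
      rw [hψ]
      simp only [p]
      ring
    rw [hT, hT, hT, hsa, hpa]
    refine Prod.ext rfl (Prod.ext rfl ?_)
    simp only
    rw [hψ]
    linear_combination (-1 / 2 : ℝ) * hsp (ψ g) (ψ h)
  · have hp1 : p (ψ k) = 1 := by
      simp only [p, ← ha, ← hb]
      rw [hN] at hk ⊢
      rw [← sq, ← sq]
      exact div_self hk
    have hs0 : s (ψ k) = 0 := by
      simp only [s, ← ha, ← hb]
      ring
    rw [hT, hp1, hs0, hw, ← ha, ← hb]
    refine Prod.ext rfl (Prod.ext rfl ?_)
    simp only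
    ring
  · rw [hT, ← ha, ← hb]
  · rw [hT] at h1 h2
    simp only at h1 h2
    have hx' := hx (ψ g) 0
    have hy' := hy (ψ g) 0
    rw [h1, h2] at hx' hy'
    exact ⟨by rw [← hx']; simp [x], by rw [← hy']; simp [y]⟩

/-- Commutators of `K` are central, hence trivial, so `K` projects into one line modulo the centre,
and injectively. Connectedness makes the projection onto; taking roots of `k` and closing up
identifies `K` with the axis through `k`. -/
theorem eq_bot_or_exists_axis (hψ : IsHeisenbergChart ψ) (K : Subgroup G)
    (hcl : IsClosed (K : Set G)) (hconn : IsPreconnected (K : Set G))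
    (hcore : ∀ k ∈ K, (∀ g, g * k = k * g) → k = 1) :
    K = ⊥ ∨ ∃ ψ' : G ≃ₜ ℝ × ℝ × ℝ, IsHeisenbergChart ψ' ∧
      ∀ g, g ∈ K ↔ (ψ' g).1 = 0 ∧ (ψ' g).2.2 = 0 := by
  have hcent (k : G) (hk : k ∈ K) (h1 : (ψ k).1 = 0) (h2 : (ψ k).2.1 = 0) : k = 1 := by
    refine hcore k hk fun g => ψ.injective ?_
    rw [hψ, hψ, h1, h2]
    refine Prod.ext (add_comm _ _) (Prod.ext (add_comm _ _) ?_)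
    simp only
    ring
  have hcomm (g h : G) (hg : g ∈ K) (hh : h ∈ K) : (ψ g).2.1 * (ψ h).1 = (ψ h).2.1 * (ψ g).1 := by
    have hc : g * h * (h * g)⁻¹ * (h * g) = g * h := inv_mul_cancel_right _ _
    have h1 := hψ (g * h * (h * g)⁻¹) (h * g)
    rw [hc, hψ g h, hψ h g] at h1
    have h2 := hcent _ (K.mul_mem (K.mul_mem hg hh) (K.inv_mem (K.mul_mem hh hg)))
      (by linarith [congrArg Prod.fst h1]) (by linarith [congrArg (fun q => q.2.1) h1])
    have h3 := congrArg (fun g => (ψ g).2.2) (mul_inv_eq_one.1 h2)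
    simp only [hψ g h, hψ h g] at h3
    linarith
  rw [or_iff_not_imp_left, ← ne_eq, Subgroup.ne_bot_iff_exists_ne_one]
  rintro ⟨⟨k, hk⟩, hk1⟩
  have hN : (ψ k).1 ^ 2 + (ψ k).2.1 ^ 2 ≠ 0 := by
    intro h
    refine hk1 (Subtype.ext (hcent k hk ?_ ?_)) <;> nlinarith [sq_nonneg (ψ k).1, sq_nonneg (ψ k).2.1]
  obtain ⟨χ, hχ, hχk, hχs, hχ0⟩ := hψ.exists_isHeisenbergChart_axis k hN
  have hs (g : G) (hg : g ∈ K) : (χ g).1 = 0 := by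
    rw [hχs]
    linarith [hcomm g k hg hk]
  have hinj (g h : G) (hg : g ∈ K) (hh : h ∈ K) (hgh : (χ g).2.1 = (χ h).2.1) : g = h := by
    have h1 : g * h⁻¹ * h = g := inv_mul_cancel_right _ _
    have hmem := K.mul_mem hg (K.inv_mem hh)
    have h2 := hχ (g * h⁻¹) h
    rw [h1] at h2
    obtain ⟨h3, h4⟩ := hχ0 _ (hs _ hmem)
      (by linarith [congrArg (fun q => q.2.1) h2])
    exact mul_inv_eq_one.1 (hcent _ hmem h3 h4)
  let P : G →* Multiplicative ℝ :=
    { toFun := fun g => Multiplicative.ofAdd (χ g).2.1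
      map_one' := by rw [hχ.map_one]; rfl
      map_mul' := fun g h => by rw [hχ]; rfl }
  have hPtop : Subgroup.toAddSubgroup' (K.map P) = ⊤ := by
    refine AddSubgroup.eq_top_of_uIcc_subset _ one_ne_zero ?_
    have him : ((fun g => (χ g).2.1) '' (K : Set G)).OrdConnected :=
      (hconn.image _ (by fun_prop)).ordConnected
    refine (him.uIcc_subset ⟨1, K.one_mem, by simp [hχ.map_one]⟩ ⟨k, hk, by simp [hχk]⟩).trans ?_
    rintro _ ⟨g, hg, rfl⟩
    exact ⟨g, hg, rfl⟩
  have hsurj (r : ℝ) : ∃ g ∈ K, (χ g).2.1 = r := by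
    have : r ∈ Subgroup.toAddSubgroup' (K.map P) := hPtop ▸ AddSubgroup.mem_top r
    obtain ⟨g, hg, h⟩ := this
    exact ⟨g, hg, h⟩
  let A : AddSubgroup ℝ :=
    { carrier := {r | χ.symm (0, r, 0) ∈ K}
      zero_mem' := by
        have : χ.symm (0, 0, 0) = 1 := by
          rw [Homeomorph.symm_apply_eq, hχ.map_one]
          rfl
        rw [Set.mem_ofPred_eq, this]
        exact K.one_mem
      add_mem' := fun {r r'} hr hr' => by
        have : χ.symm (0, r + r', 0) = χ.symm (0, r, 0) * χ.symm (0, r', 0) := by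
          rw [Homeomorph.symm_apply_eq, hχ]
          simp
        rw [Set.mem_ofPred_eq, this]
        exact K.mul_mem hr hr'
      neg_mem' := fun {r} hr => by
        have : χ.symm (0, -r, 0) = (χ.symm (0, r, 0))⁻¹ := by
          rw [eq_inv_iff_mul_eq_one]
          refine χ.injective ?_
          rw [hχ, hχ.map_one]
          simp
        rw [Set.mem_ofPred_eq, this]
        exact K.inv_mem hr }
  -- The element of `K` over `1 / n` has `n`-th power `k`, whose last coordinate is zero; hence so
  -- is its own.
  have hAinv (n : ℕ) (hn : n ≠ 0) : ((n : ℝ)⁻¹) ∈ A := by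
    obtain ⟨g, hg, hgn⟩ := hsurj (n : ℝ)⁻¹
    have hpow (m : ℕ) : χ (g ^ m) = (0, m * (χ g).2.1, m * (χ g).2.2) := by
      induction m with
      | zero => simp [hχ.map_one, Prod.ext_iff]
      | succ m ih =>
        rw [pow_succ, hχ, ih, hs g hg]
        refine Prod.ext (by simp) (Prod.ext ?_ ?_) <;> simp <;> ring
    have hn' : (n : ℝ) ≠ 0 := by exact_mod_cast hn
    have h1 : g ^ n = k := by
      refine hinj _ _ (K.pow_mem hg n) hk ?_
      rw [hpow, hχk, hgn]
      exact mul_inv_cancel₀ hn'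
    have h2 := hpow n
    rw [h1, hχk] at h2
    have h3 : (χ g).2.2 = 0 := by
      have := congrArg (fun q => q.2.2) h2
      simpa [hn'] using this.symm
    have h4 : χ.symm (0, (n : ℝ)⁻¹, 0) = g := by
      rw [Homeomorph.symm_apply_eq]
      exact Prod.ext (hs g hg).symm (Prod.ext hgn.symm h3.symm)
    change χ.symm (0, (n : ℝ)⁻¹, 0) ∈ K
    rwa [h4]
  have hA (r : ℝ) : r ∈ A := by
    have hclA : IsClosed (A : Set ℝ) := hcl.preimage (by fun_prop)
    refine Rat.denseRange_cast.induction_on (p := fun r => r ∈ A) r hclA fun q => ?_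
    have := A.zsmul_mem (hAinv q.den q.den_nz) q.num
    rwa [zsmul_eq_mul, ← div_eq_mul_inv, ← Rat.cast_def] at this
  refine ⟨χ, hχ, fun g => ⟨fun hg => ⟨hs g hg, ?_⟩, fun hg => ?_⟩⟩
  · have h1 : g = χ.symm (0, (χ g).2.1, 0) := hinj _ _ hg (hA _) (by simp)
    rw [h1]
    simp
  · have h1 : g = χ.symm (0, (χ g).2.1, 0) := by
      rw [Homeomorph.eq_symm_apply]
      exact Prod.ext hg.1 (Prod.ext rfl hg.2)
    rw [h1]
    exact hA _

end IsHeisenbergChart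

/-! ### The group generated by the left translations -/

theorem Loop.mul_right_cancel {L : Type*} [Loop L] {a b c : L} (h : a * c = b * c) : a = b := by
  rw [← Loop.mul_rdiv a c, h, Loop.mul_rdiv]

section LeftTranslationGroup

variable {L : Type*} [TopologicalSpace L] [Loop L] [IsTopologicalLoop L]

theorem leftTranslation_mem_leftTranslationGroup (a : L) :
    Loop.leftTranslation a ∈ leftTranslationGroup L :=
  subset_topologicallyGenerated _ ⟨a, rfl⟩

/-- Left translations as elements of the group that they generate. -/
def leftTranslationHom (a : L) : leftTranslationGroup L :=
  ⟨Loop.leftTranslation a, leftTranslation_mem_leftTranslationGroup a⟩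

theorem continuous_leftTranslationHom : Continuous (leftTranslationHom (L := L)) :=
  (Homeomorph.continuous_of_continuous_uncurry _ IsTopologicalLoop.continuous_mul
    IsTopologicalLoop.continuous_ldiv).subtype_mk _

theorem continuous_leftTranslationGroup_eval :
    Continuous fun g : leftTranslationGroup L => g.1 1 :=
  (Homeomorph.continuous_eval_const 1).comp continuous_subtype_val

/-- The stabilizer of the identity in the group generated by the left translations. -/
def leftTranslationStabilizer (L : Type*) [TopologicalSpace L] [Loop L] [IsTopologicalLoop L] :
    Subgroup (leftTranslationGroup L) where
  carrier := {g | g.1 1 = 1}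
  one_mem' := rfl
  mul_mem' {g h} hg hh := by
    change g.1 (h.1 1) = 1
    rw [hh, hg]
  inv_mem' {g} hg := by
    change g.1.symm 1 = 1
    rw [Homeomorph.symm_apply_eq, hg]

theorem mem_leftTranslationStabilizer {g : leftTranslationGroup L} :
    g ∈ leftTranslationStabilizer L ↔ g.1 1 = 1 := Iff.rfl

theorem inv_mul_mem_leftTranslationStabilizer {g h : leftTranslationGroup L} :
    h⁻¹ * g ∈ leftTranslationStabilizer L ↔ g.1 1 = h.1 1 :=
  Homeomorph.symm_apply_eq h.1

theorem isClosed_leftTranslationStabilizer [T2Space L] :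
    IsClosed (leftTranslationStabilizer L : Set (leftTranslationGroup L)) :=
  isClosed_eq continuous_leftTranslationGroup_eval continuous_const

/-- A central `k` fixing `1` satisfies `k a = k (a * 1) = a * k 1 = a`. -/
theorem leftTranslationStabilizer_eq_one_of_central {k : leftTranslationGroup L}
    (hk : k ∈ leftTranslationStabilizer L) (h : ∀ g, g * k = k * g) : k = 1 := by
  ext a
  have h1 := congrArg (fun f : leftTranslationGroup L => f.1 1) (h (leftTranslationHom a))
  change a * k.1 1 = k.1 (a * 1) at h1
  rw [mem_leftTranslationStabilizer.1 hk, mul_one] at h1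
  exact h1.symm

variable {ψ : leftTranslationGroup L ≃ₜ ℝ × ℝ × ℝ}

/-- The map `g ↦ (leftTranslation (g 1))⁻¹ g` retracts the group, homeomorphic to `ℝ³`, onto the
stabilizer. -/
theorem isPreconnected_leftTranslationStabilizer (hψ : IsHeisenbergChart ψ) :
    IsPreconnected (leftTranslationStabilizer L : Set (leftTranslationGroup L)) := by
  let l : leftTranslationGroup L → leftTranslationGroup L := fun g => leftTranslationHom (g.1 1)
  have hl : Continuous l := continuous_leftTranslationHom.comp continuous_leftTranslationGroup_eval
  let r : leftTranslationGroup L → leftTranslationGroup L := fun g => (l g)⁻¹ * g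
  have hr : Continuous r := by
    rw [← ψ.comp_continuous_iff]
    have h (g) : ψ (r g) = ((ψ g).1 - (ψ (l g)).1, (ψ g).2.1 - (ψ (l g)).2.1,
        (ψ g).2.2 - (ψ (l g)).2.2 + (ψ (l g)).2.1 * ((ψ g).1 - (ψ (l g)).1)) := by
      have h1 := hψ (l g) (r g)
      rw [mul_inv_cancel_left] at h1
      have h2 := congrArg Prod.fst h1
      have h3 := congrArg (fun q => q.2.1) h1
      have h4 := congrArg (fun q => q.2.2) h1
      simp only at h2 h3 h4
      rw [h2, h3, h4]
      refine Prod.ext ?_ (Prod.ext ?_ ?_) <;> simp only <;> ring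
    change Continuous fun g => ψ (r g)
    simp only [h]
    fun_prop
  have hrange : (leftTranslationStabilizer L : Set (leftTranslationGroup L)) =
      Set.range (r ∘ ψ.symm) := by
    rw [ψ.symm.surjective.range_comp]
    ext g
    constructor
    · intro hg
      refine ⟨g, ?_⟩
      have h1 : l g = 1 := by
        ext a
        change g.1 1 * a = a
        rw [mem_leftTranslationStabilizer.1 hg, one_mul]
      simp only [r, h1, inv_one, one_mul]
    · rintro ⟨g, rfl⟩
      exact inv_mul_mem_leftTranslationStabilizer.2 (mul_one _).symm
  rw [hrange]
  exact isPreconnected_range (hr.comp ψ.symm.continuous)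

/-- Otherwise evaluation at `1` would be a homeomorphism from `ℝ³` to the surface `L`. -/
theorem leftTranslationStabilizer_ne_bot [ChartedSpace (EuclideanSpace ℝ (Fin 2)) L]
    (ψ : leftTranslationGroup L ≃ₜ ℝ × ℝ × ℝ) : leftTranslationStabilizer L ≠ ⊥ := by
  intro hbot
  let ε : leftTranslationGroup L ≃ₜ L :=
    { toFun := fun g => g.1 1
      invFun := leftTranslationHom
      left_inv := fun g => by
        have h : g⁻¹ * leftTranslationHom (g.1 1) ∈ leftTranslationStabilizer L :=
          inv_mul_mem_leftTranslationStabilizer.2 (mul_one _)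
        rw [hbot, Subgroup.mem_bot, inv_mul_eq_one] at h
        exact h.symm
      right_inv := fun a => mul_one a
      continuous_toFun := continuous_leftTranslationGroup_eval
      continuous_invFun := continuous_leftTranslationHom }
  exact (isEmpty_homeomorph_of_chartedSpace_plane L).false
    (((Complex.equivRealProdCLM.toHomeomorph.prodCongr (Homeomorph.refl ℝ)).trans
      (Homeomorph.prodAssoc ℝ ℝ ℝ)).trans (ψ.symm.trans ε))

theorem exists_hasMultiplication_of_axis (hψ : IsHeisenbergChart ψ)
    (hK : ∀ g, g ∈ leftTranslationStabilizer L ↔ (ψ g).1 = 0 ∧ (ψ g).2.2 = 0) :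
    ∃ v : ℝ → ℝ, Continuous v ∧ (¬ ∃ m : ℝ, ∀ u, v u = m * u) ∧ v 0 = 0 ∧
      HasMultiplication L v := by
  -- Right multiplication by `(0, y, 0)` changes only the middle coordinate, so the outer two
  -- coordinates label the cosets.
  have hev (g h : leftTranslationGroup L) :
      g.1 1 = h.1 1 ↔ (ψ g).1 = (ψ h).1 ∧ (ψ g).2.2 = (ψ h).2.2 := by
    rw [← inv_mul_mem_leftTranslationStabilizer, hK]
    have h1 := hψ h (h⁻¹ * g)
    rw [mul_inv_cancel_left] at h1
    have h2 := congrArg Prod.fst h1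
    have h3 := congrArg (fun q => q.2.2) h1
    simp only at h2 h3
    rw [h2, h3]
    constructor
    · rintro ⟨h4, h5⟩
      simp [h4, h5]
    · rintro ⟨h4, h5⟩
      have h6 : (ψ (h⁻¹ * g)).1 = 0 := by linarith
      rw [h6] at h5
      exact ⟨h6, by linarith⟩
  have hl := continuous_leftTranslationHom (L := L)
  let φ : L ≃ₜ ℝ × ℝ :=
    { toFun := fun a => ((ψ (leftTranslationHom a)).1, (ψ (leftTranslationHom a)).2.2)
      invFun := fun q => (ψ.symm (q.1, 0, q.2)).1 1
      left_inv := fun a => by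
        refine ((hev _ (leftTranslationHom a)).2 ?_).trans (mul_one a)
        simp
      right_inv := fun q => by
        have h := (hev (leftTranslationHom ((ψ.symm (q.1, 0, q.2)).1 1))
          (ψ.symm (q.1, 0, q.2))).1 (mul_one _)
        exact Prod.ext (h.1.trans (by simp)) (h.2.trans (by simp))
      continuous_toFun := by fun_prop
      continuous_invFun := by
        refine continuous_leftTranslationGroup_eval.comp ?_
        fun_prop }
  have hφ (a : L) : φ a = ((ψ (leftTranslationHom a)).1, (ψ (leftTranslationHom a)).2.2) := rfl
  let p : L → ℝ := fun a => (ψ (leftTranslationHom a)).2.1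
  have hmul (a b : L) : φ (a * b) =
      ((φ a).1 + (φ b).1, (φ a).2 + (φ b).2 - p a * (φ b).1) := by
    have h : (leftTranslationHom (a * b)).1 1 = (leftTranslationHom a * leftTranslationHom b).1 1 := by
      change a * b * 1 = a * (b * 1)
      rw [mul_one, mul_one]
    have h1 := (hev _ _).1 h
    rw [hψ] at h1
    exact Prod.ext h1.1 h1.2
  have hp (a a' : L) (h : (φ a).1 = (φ a').1) : p a = p a' := by
    by_contra hne
    have hne' : p a - p a' ≠ 0 := sub_ne_zero.2 hne
    -- Chosen so that `a * b = a' * b`: the first coordinate of `b` makes the difference of slopes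
    -- absorb the difference of second coordinates.
    let b := φ.symm (((φ a).2 - (φ a').2) / (p a - p a'), 0)
    have hb : a * b = a' * b := by
      refine φ.injective ?_
      rw [hmul, hmul, h]
      refine Prod.ext rfl ?_
      simp only [b, Homeomorph.apply_symm_apply]
      field_simp
      ring
    exact hne (congrArg p (Loop.mul_right_cancel hb))
  let v : ℝ → ℝ := fun u => p (φ.symm (u, 0))
  have hv (a : L) : v (φ a).1 = p a := hp _ _ (by simp)
  have hone : leftTranslationHom (1 : L) = 1 := by
    ext a
    exact one_mul a
  refine ⟨v, ?_, ?_, ?_, φ, fun a b => ?_⟩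
  · simp only [v, p]
    fun_prop
  · rintro ⟨m, hm⟩
    -- If `v` were linear with slope `m`, this closed subgroup would contain all left translations,
    -- yet it misses `(0, 1, 0)`.
    let M : Subgroup (leftTranslationGroup L) :=
      { carrier := {g | (ψ g).2.1 = m * (ψ g).1}
        one_mem' := by simp [hψ.map_one]
        mul_mem' := fun {g h} hg hh => by
          simp only [Set.mem_ofPred_eq] at hg hh ⊢
          rw [hψ]
          simp only [hg, hh]
          ring
        inv_mem' := fun {g} hg => by
          simp only [Set.mem_ofPred_eq] at hg ⊢
          have h1 := hψ g g⁻¹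
          rw [mul_inv_cancel, hψ.map_one] at h1
          have h2 : 0 = (ψ g).1 + (ψ g⁻¹).1 := congrArg Prod.fst h1
          have h3 : 0 = (ψ g).2.1 + (ψ g⁻¹).2.1 := congrArg (fun q => q.2.1) h1
          linear_combination m * h2 - h3 - hg }
    have hM : leftTranslationGroup L ≤ M.map (leftTranslationGroup L).subtype := by
      refine topologicallyGenerated_le ?_ ?_
      · rw [Subgroup.coe_map]
        refine (isClosed_topologicallyGenerated _).isClosedEmbedding_subtypeVal.isClosedMap _ ?_
        exact isClosed_eq (f := fun g => (ψ g).2.1) (g := fun g => m * (ψ g).1)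
          (by fun_prop) (by fun_prop)
      · rintro _ ⟨a, rfl⟩
        refine ⟨leftTranslationHom a, ?_, rfl⟩
        change p a = m * (φ a).1
        rw [← hv, hm]
    obtain ⟨g, hg, hgeq⟩ := hM (ψ.symm (0, 1, 0)).2
    rw [Subtype.val_injective hgeq] at hg
    have : (ψ (ψ.symm (0, 1, 0))).2.1 = m * (ψ (ψ.symm (0, 1, 0))).1 := hg
    simp at this
  · have h1 : (φ 1).1 = 0 := by rw [hφ, hone, hψ.map_one]; rfl
    have h2 := hv 1
    rw [h1] at h2
    rw [h2]
    simp only [p]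
    rw [hone, hψ.map_one]
    rfl
  · rw [hmul, hv, mul_comm (p a)]

end LeftTranslationGroup

/-! ### The theorem -/

theorem theorem3 (L : Type*) [TopologicalSpace L] [T2Space L] [SecondCountableTopology L]
    [ChartedSpace (EuclideanSpace ℝ (Fin 2)) L] [SimplyConnectedSpace L]
    [Loop L] [IsTopologicalLoop L]
    (hG : Nonempty (leftTranslationGroup L ≃ₜ* Filiform.group 1)) :
    (∃ v : ℝ → ℝ, Continuous v ∧ (¬ ∃ m : ℝ, ∀ u, v u = m * u) ∧ v 0 = 0 ∧
      HasMultiplication L v) ∧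
    ∀ v : ℝ → ℝ, Continuous v → (¬ ∃ m : ℝ, ∀ u, v u = m * u) → v 0 = 0 →
      HasMultiplication L v → ∀ n : ℕ, 1 < n →
        (Nonempty (multiplicationGroup L ≃ₜ* Filiform.group n) ↔
          ∃ a : ℕ → ℝ, a n ≠ 0 ∧
            ∀ u : ℝ, v u = ∑ k ∈ Finset.Icc 1 n, (-1) ^ (k + 1) * a k * u ^ k) := by
  refine ⟨?_, fun v hv hlin hv0 hL n hn =>
    multiplicationGroup_equiv_filiform_iff hv hlin hv0 hL hn⟩
  obtain ⟨e⟩ := hG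
  obtain ⟨ψ, hψ⟩ := Filiform.exists_isHeisenbergChart e
  rcases hψ.eq_bot_or_exists_axis (leftTranslationStabilizer L) isClosed_leftTranslationStabilizer
    (isPreconnected_leftTranslationStabilizer hψ)
    (fun k hk => leftTranslationStabilizer_eq_one_of_central hk) with h | ⟨χ, hχ, hK⟩
  · exact absurd h (leftTranslationStabilizer_ne_bot ψ)
  · exact exists_hasMultiplication_of_axis hχ hK
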